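/- Let $k$ be a field and $G$ a group with unit $e$. Objects of the Hom-category are pairs $(M,\mu)$ of a $k$-vector space and $\mu\in\mathrm{Aut}_k(M)$; morphisms are linear maps commuting with these automorphisms; $(M,\mu)\otimes(N,\nu)=(M\otimes N,\mu\otimes\nu)$, the unit is $(k,\mathrm{Id})$, the associator is $\tilde a((m\otimes n)\otimes l)=\mu(m)\otimes(n\otimes\varsigma^{-1}(l))$ for $(L,\varsigma)\ni l$, and the unitors are $\tilde l(x\otimes m)=x\mu(m)=\tilde r(m\otimes x)$. **Hom-Hopf $T$-coalgebras.** A *monoidal Hom-Hopf $T$-coalgebra* $(H,\alpha)$ over $G$ consists of objects $(H_p,\alpha_p)$, $p\in G$, of the Hom-category with bilinear multiplications and units $1_p\in H_p$ satisfying $\alpha_p(a)(bc)=(ab)\alpha_p(c)$, $a1_p=1_pa=\alpha_p(a)$, $\alpha_p(ab)=\alpha_p(a)\alpha_p(b)$, $\alpha_p(1_p)=1_p$; with linear maps $\Delta_{p,q}:H_{pq}\to H_p\otimes H_q$, $c\mapsto c_{(1,p)}\otimes c_{(2,q)}$, and $\varepsilon:H_e\to k$ commuting with the $\alpha_p$ and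 satisfying $\alpha_p^{-1}(c_{(1,p)})\otimes\Delta_{q,r}(c_{(2,qr)})=\Delta_{p,q}(c_{(1,pq)})\otimes\alpha_r^{-1}(c_{(2,r)})$ and $c_{(1,p)}\varepsilon(c_{(2,e)})=\varepsilon(c_{(1,e)})c_{(2,p)}=\alpha_p^{-1}(c)$, where all $\Delta_{p,q}$ and $\varepsilon$ are multiplicative and preserve units; with an antipode, i.e. linear maps $S_p:H_p\to H_{p^{-1}}$ commuting with $\alpha$ such that $S_{p^{-1}}(h_{(1,p^{-1})})h_{(2,p)}=\varepsilon(h)1_p=h_{(1,p)}S_{p^{-1}}(h_{(2,p^{-1})})$ for $h\in H_e$; and with a crossing, i.e. linear maps $\pi_g:H_p\to H_{gpg^{-1}}$ ($g,p\in G$) that are multiplicative, preserve units, commute with $\alpha$, and satisfy $(\pi_g\otimes\pi_g)\Delta_{p,r}=\Delta_{gpg^{-1},grg^{-1}}\pi_g$, $\varepsilon\pi_g=\varepsilon$, $\pi_e=\mathrm{Id}$, $\pi_{gg'}=\pi_g\pi_{g'}$. **Yetter–Drinfeld modules.** For $p\in G$ a *$p$-Yetter–Drinfeld module* is an object $(M,\mu)$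 of the Hom-category with - a linear action $H_p\otimes M\to M$ with $\alpha_p(a)\cdot(b\cdot m)=(ab)\cdot\mu(m)$, $1_p\cdot m=\mu(m)$, $\mu(a\cdot m)=\alpha_p(a)\cdot\mu(m)$; - linear maps $\rho_r:M\to M\otimes H_r$, $m\mapsto m_{(0)}\otimes m_{(1,r)}$ ($r\in G$), with $\mu^{-1}(m_{(0)})\otimes\Delta_{a,b}(m_{(1,ab)})=m_{(0)(0)}\otimes(m_{(0)(1,a)}\otimes\alpha_b^{-1}(m_{(1,b)}))$, $m_{(0)}\varepsilon(m_{(1,e)})=\mu^{-1}(m)$, $\rho_r(\mu(m))=\mu(m_{(0)})\otimes\alpha_r(m_{(1,r)})$; - for all $r\in G$, $h\in H_{pr}$, $m\in M$, the compatibility $$h_{(1,p)}\cdot m_{(0)}\otimes h_{(2,r)}m_{(1,r)}=\mu\big((h_{(2,p)}\cdot\mu^{-1}(m))_{(0)}\big)\otimes(h_{(2,p)}\cdot\mu^{-1}(m))_{(1,r)}\,\pi_{p^{-1}}(h_{(1,prp^{-1})}).$$ Morphisms are the linear maps commuting with the automorphisms, the actions and all $\rho_r$. This gives a category $\mathcal{YD}(H)_p$.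 Let $\mathcal{YD}(H)=\bigsqcup_{p\in G}\mathcal{YD}(H)_p$ (no morphisms between different components). **Braided $T$-categories.** A *braided $T$-category* over $G$ is a monoidal category $\mathcal C$ which is a disjoint union of full subcategories $\mathcal C_p$, $p\in G$, with $\mathcal C_p\otimes\mathcal C_q\subseteq\mathcal C_{pq}$ and unit in $\mathcal C_e$; with a group homomorphism $\varphi$ from $G$ to the group of invertible strict tensor functors $\mathcal C\to\mathcal C$ such that $\varphi_g(\mathcal C_p)=\mathcal C_{gpg^{-1}}$; and with isomorphisms $c_{X,Y}:X\otimes Y\to{}^XY\otimes X$, where ${}^XY=\varphi_p(Y)$ for $X\in\mathcal C_p$, such that (with associator $a$) - $(\varphi_p(f')\otimes f)\circ c_{X,Y}=c_{X',Y'}\circ(f\otimes f')$ for $f:X\to X'$ in $\mathcal C_p$ and $f':Y\to Y'$; - $(\mathrm{Id}\otimes c_{X,Z})\circ a_{{}^XY,X,Z}\circ(c_{X,Y}\otimes\mathrm{Id})=a_{{}^XY,{}^XZ,X}\circ c_{X,Y\otimes Z}\circ a_{X,Y,Z}$; - $a^{-1}_{{}^{X\otimes Y}Z,X,Y}\circ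 c_{X\otimes Y,Z}\circ a^{-1}_{X,Y,Z}=(c_{X,{}^YZ}\otimes\mathrm{Id})\circ a^{-1}_{X,{}^YZ,Y}\circ(\mathrm{Id}\otimes c_{Y,Z})$; - $\varphi_g(c_{X,Y})=c_{\varphi_g(X),\varphi_g(Y)}$. **Theorem.** Let $(H,\alpha)$ be a monoidal Hom-Hopf $T$-coalgebra over $G$ with bijective antipode (every $S_p$ is bijective). Then the following constructions are well defined (they give Yetter–Drinfeld modules of the stated degrees and morphisms of these), and with them $\mathcal{YD}(H)$ is a braided $T$-category over $G$ with components $\mathcal{YD}(H)_p$: - *Tensor product*: for $(M,\mu)\in\mathcal{YD}(H)_p$ and $(N,\nu)\in\mathcal{YD}(H)_q$, the object $(M\otimes N,\mu\otimes\nu)\in\mathcal{YD}(H)_{pq}$ with $h\cdot(m\otimes n)=h_{(1,p)}\cdot m\otimes h_{(2,q)}\cdot n$ and $\rho_r(m\otimes n)=m_{(0)}\otimes n_{(0)}\otimes n_{(1,r)}\pi_{q^{-1}}(m_{(1,qrq^{-1})})$; the tensor product of morphisms is that of linear maps; the associator and unitors are $\tilde a,\tilde l,\tilde r$; the unit is $(k,\mathrm{Id})\in\mathcal{YD}(H)_e$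 with $h\cdot x=\varepsilon(h)x$, $\rho_r(x)=x\otimes1_r$. - *$G$-action*: $\varphi_g(M)={}^gM\in\mathcal{YD}(H)_{gpg^{-1}}$ for $M\in\mathcal{YD}(H)_p$, which is $(M,\mu)$ with $h\rightharpoonup m=\pi_{g^{-1}}(h)\cdot m$ and $\rho_r(m)=m_{(0)}\otimes\pi_g(m_{(1,g^{-1}rg)})$; $\varphi_g$ does not change the linear map underlying a morphism. - *Braiding*: for $M\in\mathcal{YD}(H)_p$, $N\in\mathcal{YD}(H)_q$, $c_{M,N}:M\otimes N\to{}^pN\otimes M$, $c_{M,N}(m\otimes n)=\big(S_{q^{-1}}(m_{(1,q^{-1})})\cdot\nu^{-1}(n)\big)\otimes\mu(m_{(0)})$. -/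

import Mathlib

universe v₁ u₁ u v w

/-! ## Braided T-categories over a group -/

section BraidedT

open CategoryTheory MonoidalCategory

/-- The data of a braided `T`-category over a group `G`: a category with a tensor product, a unit,
an associator and unitors, a degree map whose fibres are the components `C_p`, the conjugation
functors `φ_g`, and the family of maps `c_{X,Y} : X ⊗ Y ⟶ ^X Y ⊗ X`, where `^X Y = φ_{deg X} Y`.
No axiom is imposed here, except that `φ_g` is a functor and that the associator and the unitors
are isomorphisms. -/
structure TCategoryStruct (G : Type v) [Group G] (C : Type u₁) [Category.{v₁} C] extends
    MonoidalCategoryStruct C where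
  /-- the index of the component in which an object lies -/
  deg : C → G
  /-- the conjugation functor `φ_g` -/
  conj : G → C ⥤ C
  /-- the braiding `c_{X,Y}` -/
  braid : ∀ X Y : C, X ⊗ Y ⟶ (conj (deg X)).obj Y ⊗ X

/-- A braided `T`-category over `G`: a monoidal category which is the disjoint union of full
subcategories `C_p`, `p ∈ G`, with `C_p ⊗ C_q ⊆ C_{pq}`, with a group homomorphism `φ` from `G` to
the group of invertible strict tensor functors from the category to itself such that
`φ_g (C_p) = C_{g p g⁻¹}`, and with a braiding.  An equality of morphisms whose sources (or targets)
are equal objects, but not syntactically so, is written with `eqToHom`. -/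
structure BraidedTCategory (G : Type v) [Group G] (C : Type u₁) [Category.{v₁} C] extends
    TCategoryStruct G C, MonoidalCategory C where
  /-- there are no morphisms between different components -/
  deg_eq_of_hom : ∀ {X Y : C}, (X ⟶ Y) → deg X = deg Y
  deg_unit : deg (𝟙_ C) = 1
  deg_tensor : ∀ X Y : C, deg (X ⊗ Y) = deg X * deg Y
  /-- `φ` is a group homomorphism (so that every `φ_g` is invertible, with inverse `φ_{g⁻¹}`) -/
  conj_one : conj 1 = 𝟭 C
  conj_mul : ∀ g h : G, conj (g * h) = conj h ⋙ conj g
  deg_conj : ∀ (g : G) (X : C), deg ((conj g).obj X) = g * deg X * g⁻¹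
  /-- `φ_g` is a strict tensor functor: it preserves the tensor product and the unit on the nose,
  the tensor product of morphisms, the associator and the unitors -/
  conj_tensor : ∀ (g : G) (X Y : C), (conj g).obj (X ⊗ Y) = (conj g).obj X ⊗ (conj g).obj Y
  conj_unit : ∀ g : G, (conj g).obj (𝟙_ C) = 𝟙_ C
  conj_tensorHom : ∀ (g : G) {X X' Y Y' : C} (f : X ⟶ X') (f' : Y ⟶ Y'),
    (conj g).map (f ⊗ₘ f') = eqToHom (conj_tensor g X Y) ≫ ((conj g).map f ⊗ₘ (conj g).map f') ≫
      eqToHom (conj_tensor g X' Y').symm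
  conj_associator : ∀ (g : G) (X Y Z : C),
    (conj g).map (α_ X Y Z).hom =
      eqToHom (by rw [conj_tensor, conj_tensor]) ≫
        (α_ ((conj g).obj X) ((conj g).obj Y) ((conj g).obj Z)).hom ≫
        eqToHom (by rw [conj_tensor, conj_tensor])
  conj_leftUnitor : ∀ (g : G) (X : C),
    (conj g).map (λ_ X).hom =
      eqToHom (by rw [conj_tensor, conj_unit]) ≫ (λ_ ((conj g).obj X)).hom
  conj_rightUnitor : ∀ (g : G) (X : C),
    (conj g).map (ρ_ X).hom =
      eqToHom (by rw [conj_tensor, conj_unit]) ≫ (ρ_ ((conj g).obj X)).hom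
  /-- every `c_{X,Y}` is an isomorphism -/
  braid_isIso : ∀ X Y : C, IsIso (braid X Y)
  /-- for `f : X ⟶ X'` in a component `C_p` and `f' : Y ⟶ Y'` one has
  `(φ_p(f') ⊗ f) ∘ c_{X,Y} = c_{X',Y'} ∘ (f ⊗ f')` -/
  braid_naturality : ∀ {X X' Y Y' : C} (f : X ⟶ X') (f' : Y ⟶ Y'),
    braid X Y ≫ ((conj (deg X)).map f' ⊗ₘ f) =
      (f ⊗ₘ f') ≫ braid X' Y' ≫
        eqToHom (congrArg (fun g => (conj g).obj Y' ⊗ X') (deg_eq_of_hom f).symm)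
  /-- `(Id ⊗ c_{X,Z}) ∘ a ∘ (c_{X,Y} ⊗ Id) = a ∘ c_{X,Y⊗Z} ∘ a` -/
  hexagon_left : ∀ X Y Z : C,
    (braid X Y ▷ Z) ≫ (α_ ((conj (deg X)).obj Y) X Z).hom ≫
        ((conj (deg X)).obj Y ◁ braid X Z) =
      (α_ X Y Z).hom ≫ braid X (Y ⊗ Z) ≫ eqToHom (congrArg (· ⊗ X) (conj_tensor (deg X) Y Z)) ≫
        (α_ ((conj (deg X)).obj Y) ((conj (deg X)).obj Z) X).hom
  /-- `a⁻¹ ∘ c_{X⊗Y,Z} ∘ a⁻¹ = (c_{X,^Y Z} ⊗ Id) ∘ a⁻¹ ∘ (Id ⊗ c_{Y,Z})` -/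
  hexagon_right : ∀ X Y Z : C,
    (α_ X Y Z).inv ≫ braid (X ⊗ Y) Z ≫
        (α_ ((conj (deg (X ⊗ Y))).obj Z) X Y).inv ≫
        eqToHom (congrArg (fun A => (A ⊗ X) ⊗ Y)
          (show (conj (deg (X ⊗ Y))).obj Z = (conj (deg X)).obj ((conj (deg Y)).obj Z) by
            rw [deg_tensor, conj_mul, Functor.comp_obj])) =
      (X ◁ braid Y Z) ≫ (α_ X ((conj (deg Y)).obj Z) Y).inv ≫
        (braid X ((conj (deg Y)).obj Z) ▷ Y)
  /-- `φ_g (c_{X,Y}) = c_{φ_g X, φ_g Y}` -/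
  conj_braid : ∀ (g : G) (X Y : C),
    (conj g).map (braid X Y) =
      eqToHom (conj_tensor g X Y) ≫ braid ((conj g).obj X) ((conj g).obj Y) ≫
        eqToHom (show (conj (deg ((conj g).obj X))).obj ((conj g).obj Y) ⊗ (conj g).obj X =
            (conj g).obj ((conj (deg X)).obj Y ⊗ X) by
          rw [conj_tensor, deg_conj, ← Functor.comp_obj, ← conj_mul, ← Functor.comp_obj, ← conj_mul,
            inv_mul_cancel_right])

end BraidedT

/-! ## Group-cograded monoidal Hom-Hopf algebras and monoidal Hom-Hopf T-coalgebras -/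

section HomHopf

open TensorProduct

/-- A group-cograded monoidal Hom-coalgebra over `G`: a family of vector spaces `C_p` with
automorphisms `α_p`, a comultiplication `Δ_{p,q} : C_{pq} → C_p ⊗ C_q` and a counit `ε : C_e → k`.

An index that the theory only determines up to an equality in the group is a variable, together
with a proof of that equality: `Δ p q r h` with `h : p * q = r` is the map `Δ_{p,q}`, with `C_{pq}`
written as `C_r`. In this way no transport between, say, `C_{(pq)r}` and `C_{p(qr)}` is needed. -/
structure GroupCogradedHomCoalgebra (k : Type u) [Field k] (G : Type v) [Group G] where
  /-- the component `C_p` -/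
  obj : G → Type w
  [addCommGroup : ∀ p, AddCommGroup (obj p)]
  [module : ∀ p, Module k (obj p)]
  /-- the automorphism `α_p` -/
  α : ∀ p, obj p ≃ₗ[k] obj p
  /-- the comultiplication -/
  Δ : ∀ p q r : G, p * q = r → obj r →ₗ[k] obj p ⊗[k] obj q
  /-- the counit -/
  ε : obj 1 →ₗ[k] k
  /-- `α⁻¹(c₁) ⊗ Δ(c₂) = Δ(c₁) ⊗ α⁻¹(c₂)` for `c ∈ C_{pqr}` -/
  coassoc : ∀ (p q r pq qr s : G) (h₁ : p * q = pq) (h₂ : q * r = qr) (h₃ : p * qr = s)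
    (h₄ : pq * r = s) (c : obj s),
    map (α p).symm.toLinearMap (Δ q r qr h₂) (Δ p qr s h₃ c) =
      TensorProduct.assoc k (obj p) (obj q) (obj r)
        (map (Δ p q pq h₁) (α r).symm.toLinearMap (Δ pq r s h₄ c))
  counit_right : ∀ (p : G) (c : obj p),
    TensorProduct.rid k (obj p) (map LinearMap.id ε (Δ p 1 p (mul_one p) c)) = (α p).symm c
  counit_left : ∀ (p : G) (c : obj p),
    TensorProduct.lid k (obj p) (map ε LinearMap.id (Δ 1 p p (one_mul p) c)) = (α p).symm c
  comul_α : ∀ (p q r : G) (h : p * q = r) (c : obj r),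
    Δ p q r h ((α r).symm c) =
      map (α p).symm.toLinearMap (α q).symm.toLinearMap (Δ p q r h c)
  counit_α : ∀ c : obj 1, ε ((α 1).symm c) = ε c

attribute [instance] GroupCogradedHomCoalgebra.addCommGroup GroupCogradedHomCoalgebra.module

/-- A group-cograded monoidal Hom-Hopf algebra over `G`: a group-cograded monoidal Hom-coalgebra
each of whose components is a (unital) monoidal Hom-algebra, such that `Δ` and `ε` are multiplicative
and unital, with an antipode `S_p : H_p → H_{p⁻¹}`; here `S p q h` with `h : p * q = 1` is `S_p`. -/
structure GroupCogradedHomHopfAlgebra (k : Type u) [Field k] (G : Type v) [Group G] extends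
    GroupCogradedHomCoalgebra.{u, v, w} k G where
  /-- the multiplication of `H_p` -/
  mul : ∀ p, obj p →ₗ[k] obj p →ₗ[k] obj p
  /-- the unit of `H_p` -/
  one : ∀ p, obj p
  /-- the antipode -/
  S : ∀ p q : G, p * q = 1 → obj p →ₗ[k] obj q
  hom_assoc : ∀ (p : G) (a b c : obj p), mul p (α p a) (mul p b c) = mul p (mul p a b) (α p c)
  mul_one' : ∀ (p : G) (a : obj p), mul p a (one p) = α p a
  one_mul' : ∀ (p : G) (a : obj p), mul p (one p) a = α p a
  α_mul : ∀ (p : G) (a b : obj p), α p (mul p a b) = mul p (α p a) (α p b)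
  α_one : ∀ p : G, α p (one p) = one p
  comul_mul : ∀ (p q r : G) (h : p * q = r) (a b : obj r),
    Δ p q r h (mul r a b) = map₂ (mul p) (mul q) (Δ p q r h a) (Δ p q r h b)
  comul_one : ∀ (p q r : G) (h : p * q = r), Δ p q r h (one r) = one p ⊗ₜ[k] one q
  counit_mul : ∀ a b : obj 1, ε (mul 1 a b) = ε a * ε b
  counit_one : ε (one 1) = 1
  S_α : ∀ (p q : G) (h : p * q = 1) (a : obj p), S p q h (α p a) = α q (S p q h a)
  /-- `S(h₁) h₂ = ε(h) 1_p` -/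
  S_left : ∀ (p : G) (a : obj 1),
    lift (mul p) (map (S p⁻¹ p (inv_mul_cancel p)) LinearMap.id
      (Δ p⁻¹ p 1 (inv_mul_cancel p) a)) = ε a • one p
  /-- `h₁ S(h₂) = ε(h) 1_p` -/
  S_right : ∀ (p : G) (a : obj 1),
    lift (mul p) (map LinearMap.id (S p⁻¹ p (inv_mul_cancel p))
      (Δ p p⁻¹ 1 (mul_inv_cancel p) a)) = ε a • one p

/-- A monoidal Hom-Hopf `T`-coalgebra over `G`: a group-cograded monoidal Hom-Hopf algebra with a
crossing, that is, with Hom-algebra isomorphisms `π_g : H_p → H_{g p g⁻¹}` that preserve the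
comultiplication and the counit and satisfy `π_1 = Id` and `π_{gg'} = π_g π_{g'}` (so that they are
bijective); here `π g p q h` with `h : g * p * g⁻¹ = q` is the restriction of `π_g` to `H_p`. -/
structure HomHopfTCoalgebra (k : Type u) [Field k] (G : Type v) [Group G] extends
    GroupCogradedHomHopfAlgebra.{u, v, w} k G where
  /-- the crossing -/
  π : ∀ g p q : G, g * p * g⁻¹ = q → obj p →ₗ[k] obj q
  π_mul : ∀ (g p q : G) (h : g * p * g⁻¹ = q) (a b : obj p),
    π g p q h (mul p a b) = mul q (π g p q h a) (π g p q h b)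
  π_one : ∀ (g p q : G) (h : g * p * g⁻¹ = q), π g p q h (one p) = one q
  π_α : ∀ (g p q : G) (h : g * p * g⁻¹ = q) (a : obj p), π g p q h (α p a) = α q (π g p q h a)
  comul_π : ∀ (g p r s p' r' s' : G) (h : p * r = s) (h' : p' * r' = s')
    (hp : g * p * g⁻¹ = p') (hr : g * r * g⁻¹ = r') (hs : g * s * g⁻¹ = s') (a : obj s),
    map (π g p p' hp) (π g r r' hr) (Δ p r s h a) = Δ p' r' s' h' (π g s s' hs a)
  counit_π : ∀ (g : G) (h : g * 1 * g⁻¹ = 1) (a : obj 1), ε (π g 1 1 h a) = ε a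
  π_id : ∀ (p : G) (h : 1 * p * 1⁻¹ = p) (a : obj p), π 1 p p h a = a
  π_comp : ∀ (g g' p q r : G) (h : g' * p * g'⁻¹ = q) (h' : g * q * g⁻¹ = r)
    (h'' : g * g' * p * (g * g')⁻¹ = r) (a : obj p),
    π (g * g') p r h'' a = π g q r h' (π g' p q h a)

/-- The antipode is bijective: every `S_p : H_p → H_{p⁻¹}` is. -/
def HomHopfTCoalgebra.BijectiveAntipode {k : Type u} [Field k] {G : Type v} [Group G]
    (H : HomHopfTCoalgebra.{u, v, w} k G) : Prop :=
  ∀ (p q : G) (h : p * q = 1), Function.Bijective (H.S p q h)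

end HomHopf

/-! ## Yetter-Drinfeld modules -/

section YetterDrinfeld

open TensorProduct

variable {k : Type u} [Field k] {G : Type v} [Group G]

/-- The data underlying a `p`-Yetter-Drinfeld module: a vector space `M` with an automorphism `μ`,
a map `H_p ⊗ M → M` and a family of maps `ρ_r : M → M ⊗ H_r`, without any axiom. -/
structure YDData (H : HomHopfTCoalgebra.{u, v, w} k G) (p : G) where
  carrier : Type u
  [addCommGroup : AddCommGroup carrier]
  [module : Module k carrier]
  /-- the automorphism of the underlying object of the Hom-category -/
  μ : carrier ≃ₗ[k] carrier
  /-- the action of `H_p` -/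
  act : H.obj p →ₗ[k] carrier →ₗ[k] carrier
  /-- the coaction `ρ_r` -/
  coact : ∀ r : G, carrier →ₗ[k] carrier ⊗[k] H.obj r

attribute [instance] YDData.addCommGroup YDData.module

namespace YDData

variable {H : HomHopfTCoalgebra.{u, v, w} k G}

/-- The axioms of a (left-right) `p`-Yetter-Drinfeld module. -/
structure IsYD {p : G} (M : YDData H p) : Prop where
  /-- `M` is a left `(H_p, α_p)`-Hom-module -/
  act_assoc : ∀ (a b : H.obj p) (m : M.carrier),
    M.act (H.α p a) (M.act b m) = M.act (H.mul p a b) (M.μ m)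
  one_act : ∀ m : M.carrier, M.act (H.one p) m = M.μ m
  μ_act : ∀ (a : H.obj p) (m : M.carrier), M.μ (M.act a m) = M.act (H.α p a) (M.μ m)
  /-- `M` is a right `(H, α)`-Hom-comodule:
  `μ⁻¹(m₀) ⊗ Δ_{a,b}(m₁) = m₀₀ ⊗ (m₀₁ ⊗ α⁻¹(m₁))` -/
  coact_coassoc : ∀ (a b c : G) (h : a * b = c) (m : M.carrier),
    map M.μ.symm.toLinearMap (H.Δ a b c h) (M.coact c m) =
      TensorProduct.assoc k M.carrier (H.obj a) (H.obj b)
        (map (M.coact a) (H.α b).symm.toLinearMap (M.coact b m))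
  coact_counit : ∀ m : M.carrier,
    TensorProduct.rid k M.carrier (map LinearMap.id H.ε (M.coact 1 m)) = M.μ.symm m
  coact_μ : ∀ (r : G) (m : M.carrier),
    M.coact r (M.μ m) = map M.μ.toLinearMap (H.α r).toLinearMap (M.coact r m)
  /-- the compatibility condition, for `h ∈ H_{pr}`: `h₁ · m₀ ⊗ h₂ m₁` is equal to
  `μ((h₂ · μ⁻¹(m))₀) ⊗ (h₂ · μ⁻¹(m))₁ π_{p⁻¹}(h₁)`, where `Δ_{p,r}` is used on the left and
  `Δ_{prp⁻¹,p}` on the right -/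
  compat : ∀ (r s : G) (hs : p * r = s) (a : H.obj s) (m : M.carrier),
    map₂ M.act (H.mul r) (H.Δ p r s hs a) (M.coact r m) =
      map M.μ.toLinearMap (lift (H.mul r))
        (TensorProduct.assoc k M.carrier (H.obj r) (H.obj r)
          (map (M.coact r ∘ₗ M.act.flip (M.μ.symm m))
            (H.π p⁻¹ (p * r * p⁻¹) r (by group))
            (TensorProduct.comm k _ _
              (H.Δ (p * r * p⁻¹) p s (by rw [← hs, inv_mul_cancel_right]) a))))

/-- `f` is a morphism of `p`-Yetter-Drinfeld modules. -/
structure IsHom {p : G} (M N : YDData H p) (f : M.carrier →ₗ[k] N.carrier) : Prop where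
  map_μ : ∀ m, f (M.μ m) = N.μ (f m)
  map_act : ∀ (a : H.obj p) (m : M.carrier), f (M.act a m) = N.act a (f m)
  map_coact : ∀ (r : G) (m : M.carrier), N.coact r (f m) = map f LinearMap.id (M.coact r m)

theorem IsHom.id {p : G} (M : YDData H p) : IsHom M M LinearMap.id where
  map_μ _ := rfl
  map_act _ _ := rfl
  map_coact r m := by simp

theorem IsHom.comp {p : G} {M N L : YDData H p} {f : M.carrier →ₗ[k] N.carrier}
    {g : N.carrier →ₗ[k] L.carrier} (hg : IsHom N L g) (hf : IsHom M N f) :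
    IsHom M L (g ∘ₗ f) where
  map_μ m := by simp [hf.map_μ, hg.map_μ]
  map_act a m := by simp [hf.map_act, hg.map_act]
  map_coact r m := by
    have h : map (g ∘ₗ f) (LinearMap.id : H.obj r →ₗ[k] H.obj r) =
        map g LinearMap.id ∘ₗ map f LinearMap.id := by
      rw [← TensorProduct.map_comp, LinearMap.id_comp]
    rw [LinearMap.comp_apply, hg.map_coact, hf.map_coact, h, LinearMap.comp_apply]

theorem IsHom.symm {p : G} {M N : YDData H p} {e : M.carrier ≃ₗ[k] N.carrier}
    (he : IsHom M N e.toLinearMap) : IsHom N M e.symm.toLinearMap where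
  map_μ n := by
    have h := he.map_μ (e.symm n)
    simp only [LinearEquiv.coe_coe, LinearEquiv.apply_symm_apply] at h
    simp [← h]
  map_act a n := by
    have h := he.map_act a (e.symm n)
    simp only [LinearEquiv.coe_coe, LinearEquiv.apply_symm_apply] at h
    simp [← h]
  map_coact r n := by
    have h := he.map_coact r (e.symm n)
    simp only [LinearEquiv.coe_coe, LinearEquiv.apply_symm_apply] at h
    have h' : map e.symm.toLinearMap (LinearMap.id : H.obj r →ₗ[k] H.obj r) ∘ₗ
        map e.toLinearMap LinearMap.id = LinearMap.id := by
      rw [← TensorProduct.map_comp]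
      simp
    have h₂ := LinearMap.congr_fun h' (M.coact r (e.symm n))
    rw [LinearMap.comp_apply, LinearMap.id_apply] at h₂
    rw [h, h₂, LinearEquiv.coe_coe]

/-- The unit object `(k, Id)`, of degree `e`, with `h · x = ε(h) x` and `ρ_r(x) = x ⊗ 1_r`. -/
abbrev unit (H : HomHopfTCoalgebra.{u, v, w} k G) : YDData H 1 where
  carrier := k
  μ := LinearEquiv.refl k k
  act := LinearMap.mul k k ∘ₗ H.ε
  coact r := (TensorProduct.mk k k (H.obj r)).flip (H.one r)

/-- The tensor product `(M ⊗ N, μ ⊗ ν)` of `M` of degree `p` and `N` of degree `q`, of degree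
`s = pq`, with `h · (m ⊗ n) = h₁ · m ⊗ h₂ · n` and
`ρ_r(m ⊗ n) = m₀ ⊗ n₀ ⊗ n_{(1,r)} π_{q⁻¹}(m_{(1,qrq⁻¹)})`. -/
abbrev tensor {p q s : G} (M : YDData H p) (N : YDData H q) (h : p * q = s) : YDData H s where
  carrier := M.carrier ⊗[k] N.carrier
  μ := TensorProduct.congr M.μ N.μ
  act := map₂ M.act N.act ∘ₗ H.Δ p q s h
  coact r :=
    map LinearMap.id (lift ((H.mul r).flip ∘ₗ H.π q⁻¹ (q * r * q⁻¹) r (by group))) ∘ₗ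
      (TensorProduct.tensorTensorTensorComm k M.carrier (H.obj (q * r * q⁻¹))
        N.carrier (H.obj r)).toLinearMap ∘ₗ
      map (M.coact (q * r * q⁻¹)) (N.coact r)

/-- The conjugate `^g M` of `M` of degree `p`, of degree `s = g p g⁻¹`: the same vector space, with
`h ⇀ m = π_{g⁻¹}(h) · m` and `ρ_r(m) = m₀ ⊗ π_g(m_{(1,g⁻¹rg)})`. -/
abbrev conj (g : G) {p s : G} (M : YDData H p) (h : g * p * g⁻¹ = s) : YDData H s where
  carrier := M.carrier
  μ := M.μ
  act := M.act ∘ₗ H.π g⁻¹ s p (by rw [← h]; group)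
  coact r := map LinearMap.id (H.π g (g⁻¹ * r * g) r (by group)) ∘ₗ M.coact (g⁻¹ * r * g)

section Maps

variable {p q s : G}

/-- The associator `(m ⊗ n) ⊗ l ↦ μ(m) ⊗ (n ⊗ ς⁻¹(l))` of the Hom-category. -/
def assocMap (M : YDData H p) (N : YDData H q) (L : YDData H s) :
    (M.carrier ⊗[k] N.carrier) ⊗[k] L.carrier ≃ₗ[k] M.carrier ⊗[k] (N.carrier ⊗[k] L.carrier) :=
  TensorProduct.assoc k M.carrier N.carrier L.carrier ≪≫ₗ
    TensorProduct.congr M.μ (TensorProduct.congr (LinearEquiv.refl k N.carrier) L.μ.symm)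

/-- The left unitor `x ⊗ m ↦ x μ(m)` of the Hom-category. -/
def leftUnitorMap (M : YDData H p) : k ⊗[k] M.carrier ≃ₗ[k] M.carrier :=
  TensorProduct.lid k M.carrier ≪≫ₗ M.μ

/-- The right unitor `m ⊗ x ↦ x μ(m)` of the Hom-category. -/
def rightUnitorMap (M : YDData H p) : M.carrier ⊗[k] k ≃ₗ[k] M.carrier :=
  TensorProduct.rid k M.carrier ≪≫ₗ M.μ

/-- The braiding `c_{M,N}(m ⊗ n) = ^p(S_{q⁻¹}(m_{(1,q⁻¹)}) · ν⁻¹(n)) ⊗ μ(m₀)`, where `M` has degree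
`p` and `N` has degree `q`. -/
def braidMap (M : YDData H p) (N : YDData H q) :
    M.carrier ⊗[k] N.carrier →ₗ[k] N.carrier ⊗[k] M.carrier :=
  (TensorProduct.comm k M.carrier N.carrier).toLinearMap ∘ₗ
    map M.μ.toLinearMap (lift (N.act ∘ₗ H.S q⁻¹ q (inv_mul_cancel q))) ∘ₗ
    (TensorProduct.assoc k M.carrier (H.obj q⁻¹) N.carrier).toLinearMap ∘ₗ
    map (M.coact q⁻¹) N.μ.symm.toLinearMap

end Maps

end YDData

open YDData

/-- The constructions on Yetter-Drinfeld modules are well defined: the unit, tensor products and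
conjugates of Yetter-Drinfeld modules are Yetter-Drinfeld modules, and tensor products and conjugates
of morphisms, associators, unitors and braidings are morphisms of Yetter-Drinfeld modules. -/
structure YDWellDefined (H : HomHopfTCoalgebra.{u, v, w} k G) : Prop where
  unit : (YDData.unit H).IsYD
  tensor : ∀ {p q s : G} (M : YDData H p) (N : YDData H q) (h : p * q = s),
    M.IsYD → N.IsYD → (M.tensor N h).IsYD
  conj : ∀ (g : G) {p s : G} (M : YDData H p) (h : g * p * g⁻¹ = s), M.IsYD → (M.conj g h).IsYD
  tensorHom : ∀ {p q s : G} (M M' : YDData H p) (N N' : YDData H q) (h : p * q = s)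
    (f : M.carrier →ₗ[k] M'.carrier) (f' : N.carrier →ₗ[k] N'.carrier),
    M.IsYD → M'.IsYD → N.IsYD → N'.IsYD → IsHom M M' f → IsHom N N' f' →
    IsHom (M.tensor N h) (M'.tensor N' h) (map f f')
  conjHom : ∀ (g : G) {p s : G} (M M' : YDData H p) (h : g * p * g⁻¹ = s)
    (f : M.carrier →ₗ[k] M'.carrier), M.IsYD → M'.IsYD → IsHom M M' f →
    IsHom (M.conj g h) (M'.conj g h) f
  associator : ∀ {p q r s t d : G} (M : YDData H p) (N : YDData H q) (L : YDData H r)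
    (h₁ : p * q = s) (h₂ : s * r = d) (h₃ : q * r = t) (h₄ : p * t = d),
    M.IsYD → N.IsYD → L.IsYD →
    IsHom ((M.tensor N h₁).tensor L h₂) (M.tensor (N.tensor L h₃) h₄)
      (assocMap M N L).toLinearMap
  leftUnitor : ∀ {p : G} (M : YDData H p), M.IsYD →
    IsHom ((YDData.unit H).tensor M (one_mul p)) M (leftUnitorMap M).toLinearMap
  rightUnitor : ∀ {p : G} (M : YDData H p), M.IsYD →
    IsHom (M.tensor (YDData.unit H) (mul_one p)) M (rightUnitorMap M).toLinearMap
  braid : ∀ {p q s t : G} (M : YDData H p) (N : YDData H q) (h₁ : p * q = s)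
    (h₂ : p * q * p⁻¹ = t) (h₃ : t * p = s), M.IsYD → N.IsYD →
    IsHom (M.tensor N h₁) ((N.conj p h₂).tensor M h₃) (braidMap M N)

/-! ### The categories of Yetter-Drinfeld modules -/

open CategoryTheory

/-- A `p`-Yetter-Drinfeld module over `H`. -/
structure YDMod (H : HomHopfTCoalgebra.{u, v, w} k G) (p : G) where
  data : YDData H p
  isYD : data.IsYD

/-- A morphism of `p`-Yetter-Drinfeld modules. -/
@[ext]
structure YDMod.Hom {H : HomHopfTCoalgebra.{u, v, w} k G} {p : G} (M N : YDMod H p) where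
  lin : M.data.carrier →ₗ[k] N.data.carrier
  isHom : IsHom M.data N.data lin

/-- The category of `p`-Yetter-Drinfeld modules over `H`. -/
instance YDMod.category (H : HomHopfTCoalgebra.{u, v, w} k G) (p : G) : Category (YDMod H p) where
  Hom M N := YDMod.Hom M N
  id M := ⟨LinearMap.id, IsHom.id M.data⟩
  comp f g := ⟨g.lin ∘ₗ f.lin, g.isHom.comp f.isHom⟩

/-- The category of Yetter-Drinfeld modules over `H`: the disjoint union over `p ∈ G` of the
categories of `p`-Yetter-Drinfeld modules (with Mathlib's category structure on a disjoint union). -/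
abbrev YD (H : HomHopfTCoalgebra.{u, v, w} k G) := Σ p : G, YDMod H p

namespace YD

variable {H : HomHopfTCoalgebra.{u, v, w} k G}

/-- The linear equivalence underlying an isomorphism of `p`-Yetter-Drinfeld modules. -/
def mkIso {p : G} {M N : YDMod H p} (e : M.data.carrier ≃ₗ[k] N.data.carrier)
    (he : IsHom M.data N.data e.toLinearMap) : M ≅ N where
  hom := ⟨e.toLinearMap, he⟩
  inv := ⟨e.symm.toLinearMap, he.symm⟩
  hom_inv_id := YDMod.Hom.ext (LinearMap.ext fun m => e.symm_apply_apply m)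
  inv_hom_id := YDMod.Hom.ext (LinearMap.ext fun m => e.apply_symm_apply m)

/-- The tensor product of `M` of degree `p` and `N` of degree `q` as a module of degree `s = pq`. -/
abbrev tensorMod (W : YDWellDefined H) {p q s : G} (M : YDMod H p) (N : YDMod H q)
    (h : p * q = s) : YDMod H s :=
  ⟨M.data.tensor N.data h, W.tensor _ _ h M.isYD N.isYD⟩

/-- The conjugate `^g M` of `M` of degree `p` as a module of degree `s = g p g⁻¹`. -/
abbrev conjMod (W : YDWellDefined H) (g : G) {p s : G} (M : YDMod H p) (h : g * p * g⁻¹ = s) :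
    YDMod H s :=
  ⟨M.data.conj g h, W.conj g _ h M.isYD⟩

/-- The unit object. -/
abbrev unitMod (W : YDWellDefined H) : YDMod H 1 := ⟨YDData.unit H, W.unit⟩

/-- The tensor product of two objects of the disjoint union. -/
abbrev tensorObj (W : YDWellDefined H) (X Y : YD H) : YD H :=
  ⟨X.1 * Y.1, tensorMod W X.2 Y.2 rfl⟩

/-- Writing the degree `pq` of a tensor product differently does not change the object. -/
theorem tensorObj_eq (W : YDWellDefined H) {p q s : G} (M : YDMod H p) (N : YDMod H q)
    (h : p * q = s) : (⟨s, tensorMod W M N h⟩ : YD H) = tensorObj W ⟨p, M⟩ ⟨q, N⟩ := by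
  subst h
  rfl

/-- The tensor product of two morphisms is the tensor product of the underlying linear maps. -/
def tensorHom (W : YDWellDefined H) : ∀ {X X' Y Y' : YD H}, (X ⟶ X') → (Y ⟶ Y') →
    (tensorObj W X Y ⟶ tensorObj W X' Y')
  | ⟨_, M⟩, ⟨_, M'⟩, ⟨_, N⟩, ⟨_, N'⟩, .mk f, .mk f' =>
    .mk ⟨map f.lin f'.lin,
      W.tensorHom _ _ _ _ rfl _ _ M.isYD M'.isYD N.isYD N'.isYD f.isHom f'.isHom⟩

/-- The conjugation functor from the component of degree `q` to that of degree `g q g⁻¹`. -/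
def conjFunctor (W : YDWellDefined H) (g q : G) : YDMod H q ⥤ YDMod H (g * q * g⁻¹) where
  obj M := conjMod W g M rfl
  map {M N} f := ⟨f.lin, W.conjHom g _ _ rfl _ M.isYD N.isYD f.isHom⟩

/-- The tensor product, unit, associator and unitors, degree, conjugation functors and braiding of
the category of Yetter-Drinfeld modules. -/
def tCategoryStruct (W : YDWellDefined H) : TCategoryStruct G (YD H) where
  tensorObj := tensorObj W
  whiskerLeft X _ _ f := tensorHom W (𝟙 X) f
  whiskerRight f Y := tensorHom W f (𝟙 Y)
  tensorHom := tensorHom W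
  tensorUnit := ⟨1, unitMod W⟩
  associator X Y Z :=
    (Sigma.incl (X.1 * Y.1 * Z.1)).mapIso
        (mkIso (M := tensorMod W (tensorMod W X.2 Y.2 rfl) Z.2 rfl)
          (N := tensorMod W X.2 (tensorMod W Y.2 Z.2 rfl) (mul_assoc X.1 Y.1 Z.1).symm)
          (assocMap X.2.data Y.2.data Z.2.data)
          (W.associator _ _ _ rfl rfl rfl _ X.2.isYD Y.2.isYD Z.2.isYD)) ≪≫
      eqToIso (tensorObj_eq W X.2 (tensorMod W Y.2 Z.2 rfl) (mul_assoc X.1 Y.1 Z.1).symm)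
  leftUnitor X :=
    eqToIso (tensorObj_eq W (unitMod W) X.2 (one_mul X.1)).symm ≪≫
      (Sigma.incl X.1).mapIso
        (mkIso (M := tensorMod W (unitMod W) X.2 (one_mul X.1)) (N := X.2)
          (leftUnitorMap X.2.data) (W.leftUnitor _ X.2.isYD))
  rightUnitor X :=
    eqToIso (tensorObj_eq W X.2 (unitMod W) (mul_one X.1)).symm ≪≫
      (Sigma.incl X.1).mapIso
        (mkIso (M := tensorMod W X.2 (unitMod W) (mul_one X.1)) (N := X.2)
          (rightUnitorMap X.2.data) (W.rightUnitor _ X.2.isYD))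
  deg X := X.1
  conj g := Sigma.desc fun q => conjFunctor W g q ⋙ Sigma.incl (g * q * g⁻¹)
  braid X Y :=
    (Sigma.incl (X.1 * Y.1)).map
        (Y := tensorMod W (conjMod W X.1 Y.2 rfl) X.2 (inv_mul_cancel_right (X.1 * Y.1) X.1))
        (⟨braidMap X.2.data Y.2.data, W.braid _ _ rfl rfl _ X.2.isYD Y.2.isYD⟩ :
          YDMod.Hom (tensorMod W X.2 Y.2 rfl) _) ≫
      eqToHom (tensorObj_eq W (conjMod W X.1 Y.2 rfl) X.2 (inv_mul_cancel_right (X.1 * Y.1) X.1))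

end YD

end YetterDrinfeld

/-!
All structure maps of the category of Yetter-Drinfeld modules are given by formulas in Sweedler
notation, and every claim is an identity between such formulas.

**Sweedler sums.**  For a tensor `t = ∑ t₁ ⊗ t₂` and a function `f` of two variables, `sweedler t f`
is the sum `∑ f t₁ t₂`.  When `f` is bilinear, a condition discharged by `fun_prop`, it is
independent of the chosen expression for `t`.  Each axiom of `H` and of a Yetter-Drinfeld module
becomes a rewriting rule for such sums, with an arbitrary multilinear function as test function:
`HomHopfTCoalgebra.sweedler_coassoc`, `YDData.IsYD.sweedler_coassoc`, `YDData.IsYD.sweedler_compat`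
and others.  All indices in the group are variables with a proof of the relation between them, so
that no transport between components is needed.  In this form the axioms for the unit object, for
conjugates and for tensor products are direct computations; the only long one is the compatibility
condition in `YDData.IsYD.tensor`, which uses the condition for `N` and then the one for `M`.

**The braiding.**  The antipode identities show that `c_{M,N}` is inverse to
`n ⊗ m ↦ μ(m₀) ⊗ m_{(1,q)} · ν⁻¹(n)` (`YDData.braidInv`).  The formula for the inverse does not
contain the antipode.  That it is a morphism is the compatibility condition for `M` and for `N`
(`YDData.isHom_braidInv`), and the inverses of the two sides of either hexagon identity are equal by
coassociativity of a coaction or associativity of an action (`YDData.hexagon_left`,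
`YDData.hexagon_right`).  Passing to inverses gives the statements for `c_{M,N}` itself, without
using that the antipode reverses products and coproducts.

**The category.**  Conjugates and tensor products satisfy the equations of a strict action on the
nose, because the underlying vector spaces agree definitionally and the actions and coactions agree
by the axioms of the crossing (`YDData.conj_conj`, `YDData.conj_tensor`).  A morphism is determined
by its underlying linear map `YD.lin`, and the isomorphism attached to such an equality of objects
has the identity as its underlying map (`YD.lin_eqToHom`, `YD.lin_eqToHom_comp`).  Every axiom of a
braided `T`-category thus reduces to an identity of linear maps.
-/

section Sweedler

open TensorProduct

variable {k : Type*} [CommSemiring k] {A B C D P Q : Type*}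
  [AddCommMonoid A] [AddCommMonoid B] [AddCommMonoid C] [AddCommMonoid D]
  [AddCommMonoid P] [AddCommMonoid Q]
  [Module k A] [Module k B] [Module k C] [Module k D]

/-! ### Sweedler sums -/

/-- The Sweedler sum `∑ f t₁ t₂` over a fixed expression `t = ∑ t₁ ⊗ t₂` of a tensor as a sum of
pure tensors.  It makes sense for every function `f` of two variables; it is independent of the
chosen expression when `f` is bilinear, see `sweedler_eq_lift`. -/
noncomputable def sweedler (t : A ⊗[k] B) (f : A → B → P) : P :=
  ∑ i ∈ (exists_finset t).choose, f i.1 i.2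

theorem sweedler_tmul (t : A ⊗[k] B) : sweedler t (fun a b => a ⊗ₜ[k] b) = t :=
  (exists_finset t).choose_spec.symm

theorem apply_sweedler {F : Type*} [FunLike F P Q] [AddMonoidHomClass F P Q] (L : F)
    (t : A ⊗[k] B) (f : A → B → P) : L (sweedler t f) = sweedler t fun a b => L (f a b) :=
  map_sum L _ _

theorem sweedler_comm (t : A ⊗[k] B) (s : C ⊗[k] D) (f : A → B → C → D → P) :
    (sweedler t fun a b => sweedler s fun c d => f a b c d) =
      sweedler s fun c d => sweedler t fun a b => f a b c d :=
  Finset.sum_comm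

theorem sweedler_congr {t : A ⊗[k] B} {f g : A → B → P} (h : ∀ a b, f a b = g a b) :
    sweedler t f = sweedler t g :=
  congrArg _ (funext₂ h)

variable [Module k P] [Module k Q]

theorem smul_sweedler (x : k) (t : A ⊗[k] B) (f : A → B → P) :
    x • sweedler t f = sweedler t fun a b => x • f a b :=
  Finset.smul_sum

theorem sweedler_eq_lift (t : A ⊗[k] B) (f : A →ₗ[k] B →ₗ[k] P) :
    sweedler t (fun a b => f a b) = lift f t := by
  conv_rhs => rw [← sweedler_tmul t, apply_sweedler]
  simp only [lift.tmul]

/-! ### Linear dependence on one variable -/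

-- `fun_prop` discharges the bilinearity side conditions of the rewriting rules for Sweedler sums.
attribute [fun_prop] IsLinearMap

@[fun_prop]
theorem isLinearMap_id : IsLinearMap k fun x : A => x := ⟨fun _ _ => rfl, fun _ _ => rfl⟩

@[fun_prop]
theorem isLinearMap_comp {f : B → C} {g : A → B} (hf : IsLinearMap k f) (hg : IsLinearMap k g) :
    IsLinearMap k fun x => f (g x) := (hf.mk' ∘ₗ hg.mk').isLinear

@[fun_prop]
theorem isLinearMap_coe (L : A →ₗ[k] B) {f : C → A} (hf : IsLinearMap k f) :
    IsLinearMap k fun x => L (f x) := (L ∘ₗ hf.mk').isLinear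

@[fun_prop]
theorem isLinearMap_coe_equiv (L : A ≃ₗ[k] B) {f : C → A} (hf : IsLinearMap k f) :
    IsLinearMap k fun x => L (f x) := (L.toLinearMap ∘ₗ hf.mk').isLinear

@[fun_prop]
theorem isLinearMap_apply {T : C → A →ₗ[k] B} (hT : IsLinearMap k T) (a : A) :
    IsLinearMap k fun x => T x a := (LinearMap.applyₗ a ∘ₗ hT.mk').isLinear

@[fun_prop]
theorem isLinearMap_tmul_right (a : A) {f : C → B} (hf : IsLinearMap k f) :
    IsLinearMap k fun x => a ⊗ₜ[k] f x := (TensorProduct.mk k A B a ∘ₗ hf.mk').isLinear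

@[fun_prop]
theorem isLinearMap_tmul_left {f : C → A} (hf : IsLinearMap k f) (b : B) :
    IsLinearMap k fun x => f x ⊗ₜ[k] b :=
  ((TensorProduct.mk k A B).flip b ∘ₗ hf.mk').isLinear

@[fun_prop]
theorem isLinearMap_smul_right (c : k) {f : C → B} (hf : IsLinearMap k f) :
    IsLinearMap k fun x => c • f x := (c • hf.mk').isLinear

@[fun_prop]
theorem isLinearMap_smul_left {f : C → k} (hf : IsLinearMap k f) (b : B) :
    IsLinearMap k fun x => f x • b := ((LinearMap.lsmul k B).flip b ∘ₗ hf.mk').isLinear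

/-- A function of two variables that is linear in each of them is a bilinear map. -/
theorem exists_bilinear {f : A → B → P} (h₁ : ∀ b, IsLinearMap k fun a => f a b)
    (h₂ : ∀ a, IsLinearMap k fun b => f a b) :
    ∃ g : A →ₗ[k] B →ₗ[k] P, (fun a b => g a b) = f :=
  ⟨LinearMap.mk₂ k f (fun a a' b => (h₁ b).map_add a a') (fun c a b => (h₁ b).map_smul c a)
    (fun a b b' => (h₂ a).map_add b b') (fun c a b => (h₂ a).map_smul c b), rfl⟩

/-- Two linear functions on a tensor product agree if they agree on pure tensors. -/
theorem eq_of_tmul {f g : A ⊗[k] B → P} (h : ∀ a b, f (a ⊗ₜ b) = g (a ⊗ₜ b))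
    (hf : IsLinearMap k f := by fun_prop) (hg : IsLinearMap k g := by fun_prop) :
    ∀ t, f t = g t :=
  LinearMap.congr_fun (TensorProduct.ext' (g := hf.mk') (h := hg.mk') h)

/-! ### Sweedler sums of bilinear functions -/

@[fun_prop]
theorem isLinearMap_sweedler (t : A ⊗[k] B) {f : C → A → B → P}
    (hf : ∀ a b, IsLinearMap k fun x => f x a b) :
    IsLinearMap k fun x => sweedler t (f x) where
  map_add x y := by simp only [sweedler, (hf _ _).map_add, Finset.sum_add_distrib]
  map_smul c x := by simp only [sweedler, (hf _ _).map_smul, Finset.smul_sum]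

@[fun_prop]
theorem isLinearMap_sweedler_left {f : A → B → P} (h₁ : ∀ b, IsLinearMap k fun a => f a b)
    (h₂ : ∀ a, IsLinearMap k fun b => f a b) {t : C → A ⊗[k] B} (ht : IsLinearMap k t) :
    IsLinearMap k fun x => sweedler (t x) f := by
  obtain ⟨g, rfl⟩ := exists_bilinear h₁ h₂
  simp only [sweedler_eq_lift]
  exact isLinearMap_coe _ ht

theorem sweedler_pure {f : A → B → P} (h₁ : ∀ b, IsLinearMap k fun a => f a b)
    (h₂ : ∀ a, IsLinearMap k fun b => f a b) (a : A) (b : B) :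
    sweedler (a ⊗ₜ[k] b) (fun a b => f a b) = f a b := by
  obtain ⟨g, rfl⟩ := exists_bilinear h₁ h₂
  rw [sweedler_eq_lift, lift.tmul]

/-- A tensor that is itself given by a sum may be substituted into a Sweedler sum. -/
theorem sweedler_sweedler {f : A → B → P} (h₁ : ∀ b, IsLinearMap k fun a => f a b)
    (h₂ : ∀ a, IsLinearMap k fun b => f a b) (t : C ⊗[k] D) (g : C → D → A ⊗[k] B) :
    sweedler (sweedler t fun c d => g c d) (fun a b => f a b) =
      sweedler t fun c d => sweedler (g c d) fun a b => f a b := by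
  obtain ⟨e, rfl⟩ := exists_bilinear h₁ h₂
  simp only [sweedler_eq_lift, apply_sweedler]

theorem sweedler_map {f : A → B → P} (h₁ : ∀ b, IsLinearMap k fun a => f a b)
    (h₂ : ∀ a, IsLinearMap k fun b => f a b) (t : C ⊗[k] D) (g : C →ₗ[k] A) (g' : D →ₗ[k] B) :
    sweedler (map g g' t) (fun a b => f a b) = sweedler t fun c d => f (g c) (g' d) := by
  revert t
  refine eq_of_tmul fun c d => ?_
  simp (disch := fun_prop) only [map_tmul, sweedler_pure]

theorem sweedler_assoc {f : A → B → C → P} (h₁ : ∀ b c, IsLinearMap k fun a => f a b c)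
    (h₂ : ∀ a c, IsLinearMap k fun b => f a b c) (h₃ : ∀ a b, IsLinearMap k fun c => f a b c)
    (t : (A ⊗[k] B) ⊗[k] C) :
    sweedler (TensorProduct.assoc k A B C t) (fun a s => sweedler s fun b c => f a b c) =
      sweedler t fun s c => sweedler s fun a b => f a b c := by
  revert t
  refine eq_of_tmul fun s c => ?_
  revert s
  refine eq_of_tmul fun a b => ?_
  simp (disch := fun_prop) only [sweedler_pure, TensorProduct.assoc_tmul]

theorem sweedler_tmul_left (t : A ⊗[k] B) (f : A → B → P) (c : C) :
    sweedler t f ⊗ₜ[k] c = sweedler t fun a b => f a b ⊗ₜ c :=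
  apply_sweedler ((TensorProduct.mk k P C).flip c) t f

theorem sweedler_tmul_right (t : A ⊗[k] B) (f : A → B → P) (c : C) :
    c ⊗ₜ[k] sweedler t f = sweedler t fun a b => c ⊗ₜ f a b :=
  apply_sweedler (TensorProduct.mk k C P c) t f

theorem map_eq_sweedler (f : A →ₗ[k] C) (g : B →ₗ[k] D) (t : A ⊗[k] B) :
    map f g t = sweedler t fun a b => f a ⊗ₜ[k] g b := by
  conv_lhs => rw [← sweedler_tmul t, apply_sweedler]
  simp only [map_tmul]

theorem map₂_eq_sweedler (f : A →ₗ[k] C →ₗ[k] P) (g : B →ₗ[k] D →ₗ[k] Q) (t : A ⊗[k] B)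
    (s : C ⊗[k] D) : map₂ f g t s =
      sweedler t fun a b => sweedler s fun c d => f a c ⊗ₜ[k] g b d := by
  revert t
  refine eq_of_tmul fun a b => ?_
  revert s
  refine eq_of_tmul fun c d => ?_
  simp (disch := fun_prop) only [sweedler_pure, map₂_apply_tmul, map_tmul]

theorem assoc_tmul_eq_sweedler (t : A ⊗[k] B) (c : C) :
    TensorProduct.assoc k A B C (t ⊗ₜ c) = sweedler t fun a b => a ⊗ₜ (b ⊗ₜ c) := by
  revert t
  refine eq_of_tmul fun a b => ?_
  simp (disch := fun_prop) only [sweedler_pure, TensorProduct.assoc_tmul]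

theorem tmul_eq_sweedler (t : A ⊗[k] B) (c : C) :
    c ⊗ₜ[k] t = sweedler t fun a b => c ⊗ₜ (a ⊗ₜ b) := by
  rw [← sweedler_tmul_right, sweedler_tmul]

end Sweedler

section SweedlerAxioms

open TensorProduct

variable {k : Type u} [Field k] {G : Type v} [Group G] {P : Type*} [AddCommMonoid P]
  [Module k P]

namespace HomHopfTCoalgebra

variable (H : HomHopfTCoalgebra.{u, v, w} k G)

/-! ### The axioms of a Hom-Hopf T-coalgebra in Sweedler notation -/

theorem α_symm_mul (p : G) (a b : H.obj p) :
    (H.α p).symm (H.mul p a b) = H.mul p ((H.α p).symm a) ((H.α p).symm b) := by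
  rw [LinearEquiv.symm_apply_eq, H.α_mul, LinearEquiv.apply_symm_apply,
    LinearEquiv.apply_symm_apply]

theorem α_symm_one (p : G) : (H.α p).symm (H.one p) = H.one p := by
  rw [LinearEquiv.symm_apply_eq, H.α_one]

theorem π_α_symm (g p q : G) (h : g * p * g⁻¹ = q) (a : H.obj p) :
    H.π g p q h ((H.α p).symm a) = (H.α q).symm (H.π g p q h a) := by
  rw [LinearEquiv.eq_symm_apply, ← H.π_α, LinearEquiv.apply_symm_apply]

theorem counit_α' (a : H.obj 1) : H.ε (H.α 1 a) = H.ε a := by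
  rw [← H.counit_α, LinearEquiv.symm_apply_apply]

theorem mul_mul (p : G) (a b c : H.obj p) :
    H.mul p (H.mul p a b) c = H.mul p (H.α p a) (H.mul p b ((H.α p).symm c)) := by
  rw [H.hom_assoc, LinearEquiv.apply_symm_apply]

/-- The crossing is compatible with composition in the group, for an inner factor only known to
equal a product. -/
theorem π_π (g g' p q r l : G) (h : g' * p * g'⁻¹ = q) (h' : g * q * g⁻¹ = r) (e : g * g' = l)
    (a : H.obj p) :
    H.π g q r h' (H.π g' p q h a) =
      H.π l p r (by rw [← e, ← h', ← h, mul_inv_rev]; simp only [mul_assoc]) a := by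
  subst e
  exact (H.π_comp ..).symm

theorem π_eq_self (g p : G) (h : g * p * g⁻¹ = p) (hg : g = 1) (a : H.obj p) :
    H.π g p p h a = a := by
  subst hg
  exact H.π_id ..

theorem π_inv_π (g p q : G) (h : g * p * g⁻¹ = q) (h' : g⁻¹ * q * g⁻¹⁻¹ = p) (a : H.obj p) :
    H.π g⁻¹ q p h' (H.π g p q h a) = a := by
  rw [H.π_π g⁻¹ g p q p 1 h h' (inv_mul_cancel g), H.π_id]

theorem π_surjective (g p q : G) (h : g * p * g⁻¹ = q) : Function.Surjective (H.π g p q h) :=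
  fun a => ⟨H.π g⁻¹ q p (by rw [← h]; group) a, by
    rw [H.π_π g g⁻¹ q p q 1 _ h (mul_inv_cancel g), H.π_id]⟩

/-- Coassociativity: `f c₁₁ c₁₂ c₂ = f (α⁻¹ c₁) c₂₁ (α c₂₂)` for every trilinear `f`. -/
theorem sweedler_coassoc {p q r pq qr s : G} (h₁ : p * q = pq) (h₂ : q * r = qr) (h₃ : p * qr = s)
    (h₄ : pq * r = s) (c : H.obj s) {f : H.obj p → H.obj q → H.obj r → P}
    (hf₁ : ∀ b c, IsLinearMap k fun a => f a b c) (hf₂ : ∀ a c, IsLinearMap k fun b => f a b c)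
    (hf₃ : ∀ a b, IsLinearMap k fun c => f a b c) :
    (sweedler (H.Δ pq r s h₄ c) fun a b => sweedler (H.Δ p q pq h₁ a) fun a₁ a₂ => f a₁ a₂ b) =
      sweedler (H.Δ p qr s h₃ c) fun a b => sweedler (H.Δ q r qr h₂ b) fun b₁ b₂ =>
        f ((H.α p).symm a) b₁ (H.α r b₂) := by
  have h := congrArg (fun t => sweedler t fun a s => sweedler s fun b c => f a b (H.α r c))
    (H.coassoc p q r pq qr s h₁ h₂ h₃ h₄ c)
  simp (disch := fun_prop) only [sweedler_map, sweedler_assoc, LinearEquiv.coe_coe,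
    LinearEquiv.apply_symm_apply] at h
  exact h.symm

theorem sweedler_counit_right {p : G} (h : p * 1 = p) (c : H.obj p) {f : H.obj p → P}
    (hf : IsLinearMap k f) :
    (sweedler (H.Δ p 1 p h c) fun a b => H.ε b • f a) = f ((H.α p).symm c) := by
  have h := congrArg hf.mk' (H.counit_right p c)
  rw [map_eq_sweedler, apply_sweedler, apply_sweedler] at h
  simpa [hf.map_smul] using h

theorem sweedler_counit_left {p : G} (h : 1 * p = p) (c : H.obj p) {f : H.obj p → P}
    (hf : IsLinearMap k f) :
    (sweedler (H.Δ 1 p p h c) fun a b => H.ε a • f b) = f ((H.α p).symm c) := by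
  have h := congrArg hf.mk' (H.counit_left p c)
  rw [map_eq_sweedler, apply_sweedler, apply_sweedler] at h
  simpa [hf.map_smul] using h

theorem sweedler_comul_α_symm {p q r : G} (h : p * q = r) (c : H.obj r) {f : H.obj p → H.obj q → P}
    (h₁ : ∀ b, IsLinearMap k fun a => f a b) (h₂ : ∀ a, IsLinearMap k fun b => f a b) :
    sweedler (H.Δ p q r h ((H.α r).symm c)) (fun a b => f a b) =
      sweedler (H.Δ p q r h c) fun a b => f ((H.α p).symm a) ((H.α q).symm b) := by
  simp (disch := fun_prop) only [H.comul_α, sweedler_map, LinearEquiv.coe_coe]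

theorem sweedler_comul_α {p q r : G} (h : p * q = r) (c : H.obj r) {f : H.obj p → H.obj q → P}
    (h₁ : ∀ b, IsLinearMap k fun a => f a b) (h₂ : ∀ a, IsLinearMap k fun b => f a b) :
    sweedler (H.Δ p q r h (H.α r c)) (fun a b => f a b) =
      sweedler (H.Δ p q r h c) fun a b => f (H.α p a) (H.α q b) := by
  have e := H.sweedler_comul_α_symm h (H.α r c) (f := fun a b => f (H.α p a) (H.α q b))
    (by fun_prop) (by fun_prop)
  simpa only [LinearEquiv.symm_apply_apply, LinearEquiv.apply_symm_apply] using e.symm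

theorem sweedler_comul_mul {p q r : G} (h : p * q = r) (c d : H.obj r) {f : H.obj p → H.obj q → P}
    (h₁ : ∀ b, IsLinearMap k fun a => f a b) (h₂ : ∀ a, IsLinearMap k fun b => f a b) :
    sweedler (H.Δ p q r h (H.mul r c d)) (fun a b => f a b) =
      sweedler (H.Δ p q r h c) fun a b => sweedler (H.Δ p q r h d) fun a' b' =>
        f (H.mul p a a') (H.mul q b b') := by
  simp (disch := fun_prop) only [H.comul_mul, map₂_eq_sweedler, sweedler_sweedler, sweedler_pure]

theorem sweedler_comul_one {p q r : G} (h : p * q = r) {f : H.obj p → H.obj q → P}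
    (h₁ : ∀ b, IsLinearMap k fun a => f a b) (h₂ : ∀ a, IsLinearMap k fun b => f a b) :
    sweedler (H.Δ p q r h (H.one r)) (fun a b => f a b) = f (H.one p) (H.one q) := by
  simp (disch := fun_prop) only [H.comul_one, sweedler_pure]

theorem sweedler_comul_π (g : G) {p r s p' r' s' : G} (h : p * r = s) (h' : p' * r' = s')
    (hp : g * p * g⁻¹ = p') (hr : g * r * g⁻¹ = r') (hs : g * s * g⁻¹ = s') (c : H.obj s)
    {f : H.obj p' → H.obj r' → P}
    (h₁ : ∀ b, IsLinearMap k fun a => f a b) (h₂ : ∀ a, IsLinearMap k fun b => f a b) :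
    sweedler (H.Δ p' r' s' h' (H.π g s s' hs c)) (fun a b => f a b) =
      sweedler (H.Δ p r s h c) fun a b => f (H.π g p p' hp a) (H.π g r r' hr b) := by
  simp (disch := fun_prop) only [← H.comul_π g p r s p' r' s' h h' hp hr hs c, sweedler_map]

theorem sweedler_S_left (p q : G) (h : q * p = 1) (a : H.obj 1) {f : H.obj p → P}
    (hf : IsLinearMap k f) :
    (sweedler (H.Δ q p 1 h a) fun a b => f (H.mul p (H.S q p h a) b)) = H.ε a • f (H.one p) := by
  obtain rfl : q = p⁻¹ := eq_inv_of_mul_eq_one_left h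
  have e := congrArg hf.mk' (H.S_left p a)
  rw [map_eq_sweedler, apply_sweedler, apply_sweedler] at e
  simpa [hf.map_smul] using e

theorem sweedler_S_right (p q : G) (hqp : q * p = 1) (h : p * q = 1) (a : H.obj 1) {f : H.obj p → P}
    (hf : IsLinearMap k f) :
    (sweedler (H.Δ p q 1 h a) fun a b => f (H.mul p a (H.S q p hqp b))) = H.ε a • f (H.one p) := by
  obtain rfl : q = p⁻¹ := eq_inv_of_mul_eq_one_left hqp
  have e := congrArg hf.mk' (H.S_right p a)
  rw [map_eq_sweedler, apply_sweedler, apply_sweedler] at e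
  simpa [hf.map_smul] using e

end HomHopfTCoalgebra

namespace YDData

variable {H : HomHopfTCoalgebra.{u, v, w} k G}

/-! ### The axioms of a Yetter-Drinfeld module in Sweedler notation -/

namespace IsYD

variable {p : G} {M : YDData H p}

theorem μ_symm_act (hM : M.IsYD) (a : H.obj p) (m : M.carrier) :
    M.μ.symm (M.act a m) = M.act ((H.α p).symm a) (M.μ.symm m) := by
  rw [LinearEquiv.symm_apply_eq, hM.μ_act, LinearEquiv.apply_symm_apply,
    LinearEquiv.apply_symm_apply]

theorem act_act (hM : M.IsYD) (a b : H.obj p) (m : M.carrier) :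
    M.act a (M.act b m) = M.act (H.mul p ((H.α p).symm a) b) (M.μ m) := by
  rw [← hM.act_assoc, LinearEquiv.apply_symm_apply]

/-- Coassociativity: `f m₀₀ m₀₁ m₁ = f (μ⁻¹ m₀) m₁₁ (α m₁₂)` for every trilinear `f`. -/
theorem sweedler_coassoc (hM : M.IsYD) {a b c : G} (h : a * b = c) (m : M.carrier)
    {f : M.carrier → H.obj a → H.obj b → P}
    (hf₁ : ∀ b c, IsLinearMap k fun a => f a b c) (hf₂ : ∀ a c, IsLinearMap k fun b => f a b c)
    (hf₃ : ∀ a b, IsLinearMap k fun c => f a b c) :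
    (sweedler (M.coact b m) fun x y => sweedler (M.coact a x) fun x₁ x₂ => f x₁ x₂ y) =
      sweedler (M.coact c m) fun x y => sweedler (H.Δ a b c h y) fun y₁ y₂ =>
        f (M.μ.symm x) y₁ (H.α b y₂) := by
  have e := congrArg (fun t => sweedler t fun x s => sweedler s fun y z => f x y (H.α b z))
    (hM.coact_coassoc a b c h m)
  simp (disch := fun_prop) only [sweedler_map, sweedler_assoc, LinearEquiv.coe_coe,
    LinearEquiv.apply_symm_apply] at e
  exact e.symm

theorem sweedler_counit (hM : M.IsYD) (m : M.carrier) {f : M.carrier → P} (hf : IsLinearMap k f) :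
    (sweedler (M.coact 1 m) fun x y => H.ε y • f x) = f (M.μ.symm m) := by
  have h := congrArg hf.mk' (hM.coact_counit m)
  rw [map_eq_sweedler, apply_sweedler, apply_sweedler] at h
  simpa [hf.map_smul] using h

theorem sweedler_μ (hM : M.IsYD) {r : G} (m : M.carrier) {f : M.carrier → H.obj r → P}
    (h₁ : ∀ b, IsLinearMap k fun a => f a b) (h₂ : ∀ a, IsLinearMap k fun b => f a b) :
    sweedler (M.coact r (M.μ m)) (fun x y => f x y) =
      sweedler (M.coact r m) fun x y => f (M.μ x) (H.α r y) := by
  simp (disch := fun_prop) only [hM.coact_μ, sweedler_map, LinearEquiv.coe_coe]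

theorem sweedler_μ_symm (hM : M.IsYD) {r : G} (m : M.carrier) {f : M.carrier → H.obj r → P}
    (h₁ : ∀ b, IsLinearMap k fun a => f a b) (h₂ : ∀ a, IsLinearMap k fun b => f a b) :
    sweedler (M.coact r (M.μ.symm m)) (fun x y => f x y) =
      sweedler (M.coact r m) fun x y => f (M.μ.symm x) ((H.α r).symm y) := by
  have e := hM.sweedler_μ (M.μ.symm m) (f := fun a b => f (M.μ.symm a) ((H.α r).symm b))
    (by fun_prop) (by fun_prop)
  simpa only [LinearEquiv.symm_apply_apply, LinearEquiv.apply_symm_apply] using e.symm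

/-- The right-hand side of the compatibility condition in Sweedler notation. -/
theorem compat_rhs_eq_sweedler (M : YDData H p) {r u : G} (hr : p⁻¹ * u * p⁻¹⁻¹ = r)
    (m : M.carrier) (t : H.obj u ⊗[k] H.obj p) :
    map M.μ.toLinearMap (lift (H.mul r)) (TensorProduct.assoc k M.carrier (H.obj r) (H.obj r)
        (map (M.coact r ∘ₗ M.act.flip (M.μ.symm m)) (H.π p⁻¹ u r hr)
          (TensorProduct.comm k _ _ t))) =
      sweedler t fun a b => sweedler (M.coact r (M.act b (M.μ.symm m))) fun x y =>
        M.μ x ⊗ₜ[k] H.mul r y (H.π p⁻¹ u r hr a) := by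
  revert t
  refine eq_of_tmul fun a b => ?_
  simp (disch := fun_prop) only [comm_tmul, map_tmul, assoc_tmul_eq_sweedler, apply_sweedler,
    sweedler_pure, lift.tmul, LinearMap.comp_apply, LinearMap.flip_apply, LinearEquiv.coe_coe]

/-- The compatibility condition `f (h₁ · m₀) (h₂ m₁) =
f (μ (h₂ · μ⁻¹ m)₀) ((h₂ · μ⁻¹ m)₁ π_{p⁻¹}(h₁))` for every bilinear `f`. -/
theorem sweedler_compat (hM : M.IsYD) {r s u : G} (hs : p * r = s) (hu : u * p = s)
    (hr : p⁻¹ * u * p⁻¹⁻¹ = r) (c : H.obj s) (m : M.carrier) {f : M.carrier → H.obj r → P}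
    (h₁ : ∀ b, IsLinearMap k fun a => f a b) (h₂ : ∀ a, IsLinearMap k fun b => f a b) :
    (sweedler (H.Δ p r s hs c) fun a b => sweedler (M.coact r m) fun x y =>
        f (M.act a x) (H.mul r b y)) =
      sweedler (H.Δ u p s hu c) fun a b => sweedler (M.coact r (M.act b (M.μ.symm m))) fun x y =>
        f (M.μ x) (H.mul r y (H.π p⁻¹ u r hr a)) := by
  obtain rfl : u = p * r * p⁻¹ := by rw [eq_mul_inv_iff_mul_eq, hu, hs]
  have e := congrArg (fun t => sweedler t f) (hM.compat r s hs c m)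
  simp (disch := fun_prop) only [map₂_eq_sweedler, compat_rhs_eq_sweedler, sweedler_sweedler,
    sweedler_pure] at e
  exact e

/-- The axioms of a Yetter-Drinfeld module in Sweedler notation imply the axioms. -/
theorem of_sweedler {M : YDData H p}
    (act_assoc : ∀ (a b : H.obj p) (m : M.carrier),
      M.act (H.α p a) (M.act b m) = M.act (H.mul p a b) (M.μ m))
    (one_act : ∀ m : M.carrier, M.act (H.one p) m = M.μ m)
    (μ_act : ∀ (a : H.obj p) (m : M.carrier), M.μ (M.act a m) = M.act (H.α p a) (M.μ m))
    (coassoc : ∀ (a b c : G) (h : a * b = c) (m : M.carrier),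
      (sweedler (M.coact c m) fun x y => sweedler (H.Δ a b c h y) fun y₁ y₂ =>
          (M.μ.symm x ⊗ₜ[k] (y₁ ⊗ₜ[k] y₂))) =
        sweedler (M.coact b m) fun x y => sweedler (M.coact a x) fun x₁ x₂ =>
          (x₁ ⊗ₜ[k] (x₂ ⊗ₜ[k] (H.α b).symm y)))
    (counit : ∀ m : M.carrier, (sweedler (M.coact 1 m) fun x y => H.ε y • x) = M.μ.symm m)
    (coact_μ : ∀ (r : G) (m : M.carrier), M.coact r (M.μ m) =
      sweedler (M.coact r m) fun x y => M.μ x ⊗ₜ[k] H.α r y)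
    (compat : ∀ (r s u : G) (hs : p * r = s) (hu : u * p = s) (hr : p⁻¹ * u * p⁻¹⁻¹ = r)
      (c : H.obj s) (m : M.carrier),
      (sweedler (H.Δ p r s hs c) fun a b => sweedler (M.coact r m) fun x y =>
          M.act a x ⊗ₜ[k] H.mul r b y) =
        sweedler (H.Δ u p s hu c) fun a b => sweedler (M.coact r (M.act b (M.μ.symm m))) fun x y =>
          M.μ x ⊗ₜ[k] H.mul r y (H.π p⁻¹ u r hr a)) : M.IsYD where
  act_assoc := act_assoc
  one_act := one_act
  μ_act := μ_act
  coact_coassoc a b c h m := by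
    rw [map_eq_sweedler, map_eq_sweedler, apply_sweedler]
    refine Eq.trans ?_ ((coassoc a b c h m).trans ?_)
    · exact congrArg _ (funext₂ fun x y => tmul_eq_sweedler _ _)
    · exact congrArg _ (funext₂ fun x y => (assoc_tmul_eq_sweedler _ _).symm)
  coact_counit m := by
    simpa [map_eq_sweedler, apply_sweedler] using counit m
  coact_μ r m := by rw [coact_μ, map_eq_sweedler]; rfl
  compat r s hs c m := by
    rw [map₂_eq_sweedler, compat_rhs_eq_sweedler]
    exact compat ..

end IsYD

end YDData

end SweedlerAxioms

section YDConstructions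

open TensorProduct

variable {k : Type u} [Field k] {G : Type v} [Group G] {H : HomHopfTCoalgebra.{u, v, w} k G}

namespace YDData

/-! ### The unit object and conjugates -/

/-- The action on a tensor product in Sweedler notation. -/
theorem tensor_act_tmul {p q s : G} (M : YDData H p) (N : YDData H q) (h : p * q = s)
    (c : H.obj s) (m : M.carrier) (n : N.carrier) :
    (M.tensor N h).act c (m ⊗ₜ n) = sweedler (H.Δ p q s h c) fun a b => M.act a m ⊗ₜ N.act b n := by
  refine (map₂_eq_sweedler M.act N.act (H.Δ p q s h c) (m ⊗ₜ n)).trans ?_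
  simp (disch := fun_prop) only [sweedler_pure]

/-- The coaction of a tensor product in Sweedler notation, the index `q r q⁻¹` being a variable. -/
theorem tensor_coact_tmul {p q s : G} (M : YDData H p) (N : YDData H q) (h : p * q = s)
    {r u : G} (hu : q⁻¹ * u * q⁻¹⁻¹ = r) (m : M.carrier) (n : N.carrier) :
    (M.tensor N h).coact r (m ⊗ₜ n) =
      sweedler (M.coact u m) fun x a => sweedler (N.coact r n) fun y b =>
        (x ⊗ₜ y) ⊗ₜ H.mul r b (H.π q⁻¹ u r hu a) := by
  obtain rfl : u = q * r * q⁻¹ := by rw [← hu]; group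
  simp only [LinearMap.comp_apply, map_tmul]
  generalize M.coact (q * r * q⁻¹) m = t
  generalize N.coact r n = t'
  revert t
  refine eq_of_tmul fun x a => ?_
  revert t'
  refine eq_of_tmul fun y b => ?_
  simp (disch := fun_prop) only [sweedler_pure, LinearEquiv.coe_coe, tensorTensorTensorComm_tmul,
    map_tmul, lift.tmul, LinearMap.comp_apply, LinearMap.flip_apply, LinearMap.id_apply]

/-- The coaction of a conjugate in Sweedler notation, the index `g⁻¹ r g` being a variable. -/
theorem conj_coact (g : G) {p s : G} (M : YDData H p) (h : g * p * g⁻¹ = s) {r u : G}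
    (hu : g * u * g⁻¹ = r) (m : M.carrier) :
    (M.conj g h).coact r m = sweedler (M.coact u m) fun x a => x ⊗ₜ H.π g u r hu a := by
  obtain rfl : u = g⁻¹ * r * g := by rw [← hu]; group
  exact map_eq_sweedler ..

theorem IsYD.unit : (YDData.unit H).IsYD := by
  refine .of_sweedler ?_ ?_ ?_ ?_ ?_ ?_ ?_
  · intro a b m
    simp [H.counit_mul, H.counit_α', mul_assoc]
  · intro m
    simp [H.counit_one]
  · intro a m
    simp [H.counit_α']
  · intro a b c h m
    simp (disch := fun_prop) only [LinearMap.flip_apply, mk_apply, sweedler_pure, H.comul_one]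
    simp [H.α_symm_one]
  · intro m
    simp (disch := fun_prop) only [LinearMap.flip_apply, mk_apply, sweedler_pure]
    simp [H.counit_one]
  · intro r m
    simp (disch := fun_prop) only [LinearMap.flip_apply, mk_apply, sweedler_pure]
    simp [H.α_one]
  · intro r s u hs hu hr c m
    obtain rfl : s = r := by simpa using hs.symm
    obtain rfl : u = s := by simpa using hu
    simp (disch := fun_prop) only [LinearMap.flip_apply, mk_apply, sweedler_pure]
    simp only [H.mul_one', H.one_mul', LinearMap.comp_apply, LinearMap.mul_apply',
      LinearEquiv.refl_apply, LinearEquiv.refl_symm]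
    have h₁ := H.sweedler_counit_left hs c (f := fun b => m ⊗ₜ[k] H.α u b) (by fun_prop)
    have h₂ := H.sweedler_counit_right hu c (f := fun b => m ⊗ₜ[k] H.α u (H.π 1⁻¹ u u hr b))
      (by fun_prop)
    simp only [smul_tmul', smul_eq_mul] at h₁ h₂
    rw [h₁, h₂, H.π_eq_self _ _ _ inv_one]

theorem IsYD.conj (g : G) {p s : G} {M : YDData H p} (h : g * p * g⁻¹ = s) (hM : M.IsYD) :
    (M.conj g h).IsYD := by
  refine .of_sweedler ?_ ?_ ?_ ?_ ?_ ?_ ?_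
  · intro a b m
    simp only [LinearMap.comp_apply, H.π_α, H.π_mul, hM.act_assoc]
  · intro m
    simp only [LinearMap.comp_apply, H.π_one, hM.one_act]
  · intro a m
    simp only [LinearMap.comp_apply, H.π_α, hM.μ_act]
  · intro a b c hab m
    have ha : g * (g⁻¹ * a * g) * g⁻¹ = a := by group
    have hb : g * (g⁻¹ * b * g) * g⁻¹ = b := by group
    have hc : g * (g⁻¹ * c * g) * g⁻¹ = c := by group
    have hab' : (g⁻¹ * a * g) * (g⁻¹ * b * g) = g⁻¹ * c * g := by rw [← hab]; group
    simp (disch := fun_prop) only [M.conj_coact g h ha, M.conj_coact g h hb, M.conj_coact g h hc,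
      sweedler_sweedler, sweedler_pure, H.sweedler_comul_π g hab' hab ha hb hc]
    rw [hM.sweedler_coassoc hab' m (by fun_prop) (by fun_prop) (by fun_prop)]
    simp only [H.π_α, LinearEquiv.symm_apply_apply]
  · intro m
    have h1 : g * 1 * g⁻¹ = 1 := by group
    simp (disch := fun_prop) only [M.conj_coact g h h1, sweedler_sweedler, sweedler_pure,
      H.counit_π]
    exact hM.sweedler_counit m (by fun_prop)
  · intro r m
    have hr : g * (g⁻¹ * r * g) * g⁻¹ = r := by group
    simp (disch := fun_prop) only [M.conj_coact g h hr, sweedler_sweedler, sweedler_pure,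
      hM.sweedler_μ, H.π_α]
  · intro r s' u hs hu hr c m
    have hr' : g * (g⁻¹ * r * g) * g⁻¹ = r := by group
    have hu' : g * (g⁻¹ * u * g) * g⁻¹ = u := by group
    have hs₁ : g * (g⁻¹ * s' * g) * g⁻¹ = s' := by group
    have hs₂ : p * (g⁻¹ * r * g) = g⁻¹ * s' * g := by rw [← hs, ← h]; group
    have hu₂ : (g⁻¹ * u * g) * p = g⁻¹ * s' * g := by rw [← hu, ← h]; group
    have hr₂ : p⁻¹ * (g⁻¹ * u * g) * p⁻¹⁻¹ = g⁻¹ * r * g := by rw [← hr, ← h]; group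
    have e : s⁻¹ * g = g * p⁻¹ := by rw [← h]; group
    -- every element of the component is in the image of `π_g`
    obtain ⟨c, rfl⟩ := H.π_surjective g _ _ hs₁ c
    simp (disch := fun_prop) only [M.conj_coact g h hr', sweedler_sweedler, sweedler_pure,
      LinearMap.comp_apply, H.sweedler_comul_π g hs₂ hs h hr' hs₁,
      H.sweedler_comul_π g hu₂ hu hu' h hs₁, H.π_inv_π, ← H.π_mul]
    rw [hM.sweedler_compat hs₂ hu₂ hr₂ c m (f := fun x y => x ⊗ₜ[k] H.π g _ _ hr' y)
      (by fun_prop) (by fun_prop)]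
    simp only [H.π_mul, H.π_π g p⁻¹ _ _ _ _ hr₂ hr' rfl, H.π_π s⁻¹ g _ _ _ _ hu' hr e]

/-! ### Tensor products -/

theorem IsYD.tensor {p q s : G} {M : YDData H p} {N : YDData H q} (h : p * q = s) (hM : M.IsYD)
    (hN : N.IsYD) : (M.tensor N h).IsYD := by
  refine .of_sweedler ?_ ?_ ?_ ?_ ?_ ?_ ?_
  · intro a b
    refine eq_of_tmul fun m n => ?_
    simp (disch := fun_prop) only [M.tensor_act_tmul N h, apply_sweedler, congr_tmul,
      H.sweedler_comul_α, H.sweedler_comul_mul, hM.act_assoc, hN.act_assoc]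
    rw [sweedler_comm]
  · refine eq_of_tmul fun m n => ?_
    simp (disch := fun_prop) only [M.tensor_act_tmul N h, H.sweedler_comul_one, hM.one_act,
      hN.one_act, congr_tmul]
  · intro a
    refine eq_of_tmul fun m n => ?_
    simp (disch := fun_prop) only [M.tensor_act_tmul N h, apply_sweedler, congr_tmul,
      H.sweedler_comul_α, hM.μ_act, hN.μ_act]
  · intro a b c hab
    refine eq_of_tmul fun m n => ?_
    have ha : q⁻¹ * (q * a * q⁻¹) * q⁻¹⁻¹ = a := by group
    have hb : q⁻¹ * (q * b * q⁻¹) * q⁻¹⁻¹ = b := by group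
    have hc : q⁻¹ * (q * c * q⁻¹) * q⁻¹⁻¹ = c := by group
    have hab' : (q * a * q⁻¹) * (q * b * q⁻¹) = q * c * q⁻¹ := by rw [← hab]; group
    simp (disch := fun_prop) only [M.tensor_coact_tmul N h ha, M.tensor_coact_tmul N h hb,
      M.tensor_coact_tmul N h hc,
      sweedler_sweedler, sweedler_pure, H.sweedler_comul_mul,
      H.sweedler_comul_π q⁻¹ hab' hab ha hb hc]
    simp only [congr_symm_tmul]
    symm
    refine (sweedler_congr fun x y => sweedler_comm ..).trans ?_
    simp (disch := fun_prop) only [hM.sweedler_coassoc hab', hN.sweedler_coassoc hab]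
    refine sweedler_congr fun x y => (sweedler_comm ..).trans ?_
    refine sweedler_congr fun x' y' => (sweedler_comm ..).trans ?_
    simp only [H.π_α, ← H.α_mul, LinearEquiv.symm_apply_apply]
  · refine eq_of_tmul fun m n => ?_
    have h1 : q⁻¹ * 1 * q⁻¹⁻¹ = 1 := by group
    simp (disch := fun_prop) only [M.tensor_coact_tmul N h h1, sweedler_sweedler, sweedler_pure,
      H.counit_π, H.counit_mul]
    simp (disch := fun_prop) only [mul_smul, hN.sweedler_counit,
      congr_symm_tmul]
    exact hM.sweedler_counit m (by fun_prop)
  · intro r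
    refine eq_of_tmul fun m n => ?_
    have hr : q⁻¹ * (q * r * q⁻¹) * q⁻¹⁻¹ = r := by group
    simp (disch := fun_prop) only [M.tensor_coact_tmul N h hr, sweedler_sweedler, sweedler_pure,
      hM.sweedler_μ, hN.sweedler_μ, H.π_α, H.α_mul, congr_tmul]
  · intro r t u hs hu hr c
    refine eq_of_tmul fun m n => ?_
    have hr' : q⁻¹ * (q * r * q⁻¹) * q⁻¹⁻¹ = r := by group
    have hs₁ : p * (q * r) = t := by rw [← hs, ← h]; group
    have hs₂ : (q * r * q⁻¹) * q = q * r := by group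
    have hs₃ : (p * (q * r * q⁻¹)) * q = t := by rw [← hs, ← h]; group
    have hu₁ : u * p = p * (q * r * q⁻¹) := by rw [← hr, ← h]; group
    have hr₁ : p⁻¹ * u * p⁻¹⁻¹ = q * r * q⁻¹ := by rw [← hr, ← h]; group
    simp (disch := fun_prop) only [M.tensor_coact_tmul N h hr', M.tensor_act_tmul N h,
      sweedler_sweedler, sweedler_pure, congr_tmul, congr_symm_tmul, apply_sweedler,
      sweedler_tmul_left]
    -- Coassociativity of `H` isolates the factor of `h` that meets `N`, the compatibility of `N`
    -- moves it past the coaction, and the same is then done for `M`.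
    calc
      _ = sweedler (H.Δ s r t hs c) fun a b => sweedler (H.Δ p q s h a) fun a₁ a₂ =>
            sweedler (M.coact (q * r * q⁻¹) m) fun x y => sweedler (N.coact r n) fun x' y' =>
              (M.act a₁ x ⊗ₜ[k] N.act a₂ x') ⊗ₜ[k] H.mul r b (H.mul r y' (H.π q⁻¹ _ r hr' y)) := by
        refine sweedler_congr fun a b => ?_
        exact (sweedler_congr fun x y => sweedler_comm ..).trans (sweedler_comm ..)
      _ = sweedler (H.Δ p (q * r) t hs₁ c) fun a b =>
            sweedler (M.coact (q * r * q⁻¹) m) fun x y =>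
              sweedler (H.Δ q r _ rfl b) fun b₁ b₂ => sweedler (N.coact r n) fun x' y' =>
                (M.act ((H.α p).symm a) x ⊗ₜ[k] N.act b₁ x') ⊗ₜ[k]
                  H.mul r (H.mul r b₂ y') (H.α r (H.π q⁻¹ _ r hr' y)) := by
        rw [H.sweedler_coassoc h rfl hs₁ hs c (by fun_prop) (by fun_prop) (by fun_prop)]
        simp only [H.hom_assoc]
        exact sweedler_congr fun a b => sweedler_comm ..
      _ = sweedler (H.Δ p (q * r) t hs₁ c) fun a b =>
            sweedler (M.coact (q * r * q⁻¹) m) fun x y =>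
              sweedler (H.Δ (q * r * q⁻¹) q _ hs₂ b) fun b₁ b₂ =>
                sweedler (N.coact r (N.act b₂ (N.μ.symm n))) fun x' y' =>
                  (M.act ((H.α p).symm a) x ⊗ₜ[k] N.μ x') ⊗ₜ[k]
                    H.mul r (H.α r y') (H.π q⁻¹ _ r hr' (H.mul _ b₁ y)) := by
        refine sweedler_congr fun a b => sweedler_congr fun x y => ?_
        rw [hN.sweedler_compat rfl hs₂ hr' b n (f := fun x' y' =>
          (M.act ((H.α p).symm a) x ⊗ₜ[k] x') ⊗ₜ[k] H.mul r y' (H.α r (H.π q⁻¹ _ r hr' y)))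
          (by fun_prop) (by fun_prop)]
        simp only [← H.hom_assoc, H.π_mul]
      _ = sweedler (H.Δ (p * (q * r * q⁻¹)) q t hs₃ c) fun a b =>
            sweedler (H.Δ p (q * r * q⁻¹) _ rfl a) fun a₁ a₂ =>
              sweedler (M.coact (q * r * q⁻¹) m) fun x y =>
                sweedler (N.coact r (N.act ((H.α q).symm b) (N.μ.symm n))) fun x' y' =>
                  (M.act a₁ x ⊗ₜ[k] N.μ x') ⊗ₜ[k]
                    H.mul r (H.α r y') (H.π q⁻¹ _ r hr' (H.mul _ a₂ y)) := by
        rw [H.sweedler_coassoc rfl hs₂ hs₁ hs₃ c (by fun_prop) (by fun_prop) (by fun_prop)]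
        simp only [LinearEquiv.symm_apply_apply]
        exact sweedler_congr fun a b => sweedler_comm ..
      _ = sweedler (H.Δ (p * (q * r * q⁻¹)) q t hs₃ c) fun a b =>
            sweedler (H.Δ u p _ hu₁ a) fun a₁ a₂ =>
              sweedler (M.coact (q * r * q⁻¹) (M.act a₂ (M.μ.symm m))) fun x y =>
                sweedler (N.coact r (N.act ((H.α q).symm b) (N.μ.symm n))) fun x' y' =>
                  (M.μ x ⊗ₜ[k] N.μ x') ⊗ₜ[k]
                    H.mul r (H.α r y') (H.π q⁻¹ _ r hr' (H.mul _ y (H.π p⁻¹ _ _ hr₁ a₁))) := by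
        refine sweedler_congr fun a b => ?_
        rw [hM.sweedler_compat rfl hu₁ hr₁ a m (f := fun x y =>
          sweedler (N.coact r (N.act ((H.α q).symm b) (N.μ.symm n))) fun x' y' =>
            (x ⊗ₜ[k] N.μ x') ⊗ₜ[k] H.mul r (H.α r y') (H.π q⁻¹ _ r hr' y))
          (by fun_prop) (by fun_prop)]
      _ = _ := by
        rw [H.sweedler_coassoc hu₁ h hu hs₃ c (by fun_prop) (by fun_prop) (by fun_prop)]
        have e : q⁻¹ * p⁻¹ = s⁻¹ := by rw [← h]; group
        simp only [LinearEquiv.symm_apply_apply, H.mul_mul, H.π_mul, H.π_α_symm,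
          H.π_π q⁻¹ p⁻¹ _ _ _ _ hr₁ hr' e]

end YDData

end YDConstructions

section YDMorphisms

open TensorProduct

variable {k : Type u} [Field k] {G : Type v} [Group G] {H : HomHopfTCoalgebra.{u, v, w} k G}

namespace YDData

/-! ### Morphisms of Yetter-Drinfeld modules -/

section Hom

variable {P : Type*} [AddCommMonoid P] [Module k P]

theorem IsHom.of_sweedler {p : G} {M N : YDData H p} {f : M.carrier →ₗ[k] N.carrier}
    (map_μ : ∀ m, f (M.μ m) = N.μ (f m))
    (map_act : ∀ (a : H.obj p) (m : M.carrier), f (M.act a m) = N.act a (f m))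
    (map_coact : ∀ (r : G) (m : M.carrier), N.coact r (f m) =
      sweedler (M.coact r m) fun x y => f x ⊗ₜ[k] y) : IsHom M N f where
  map_μ := map_μ
  map_act := map_act
  map_coact r m := by
    rw [map_coact, map_eq_sweedler]
    rfl

theorem IsHom.sweedler_coact {p r : G} {M N : YDData H p} {f : M.carrier →ₗ[k] N.carrier}
    (hf : IsHom M N f) (m : M.carrier) {F : N.carrier → H.obj r → P}
    (h₁ : ∀ b, IsLinearMap k fun a => F a b) (h₂ : ∀ a, IsLinearMap k fun b => F a b) :
    sweedler (N.coact r (f m)) (fun x y => F x y) =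
      sweedler (M.coact r m) fun x y => F (f x) y := by
  simp (disch := fun_prop) only [hf.map_coact, sweedler_map, LinearMap.id_apply]

end Hom

theorem IsHom.tensor {p q s : G} {M M' : YDData H p} {N N' : YDData H q} (h : p * q = s)
    {f : M.carrier →ₗ[k] M'.carrier} {f' : N.carrier →ₗ[k] N'.carrier} (hf : IsHom M M' f)
    (hf' : IsHom N N' f') : IsHom (M.tensor N h) (M'.tensor N' h) (map f f') := by
  refine .of_sweedler ?_ ?_ ?_
  · refine eq_of_tmul fun m n => ?_
    simp only [congr_tmul, map_tmul, hf.map_μ, hf'.map_μ]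
  · intro a
    refine eq_of_tmul fun m n => ?_
    simp only [M.tensor_act_tmul N h, M'.tensor_act_tmul N' h, apply_sweedler, map_tmul,
      hf.map_act, hf'.map_act]
  · intro r
    refine eq_of_tmul fun m n => ?_
    have hr : q⁻¹ * (q * r * q⁻¹) * q⁻¹⁻¹ = r := by group
    simp (disch := fun_prop) only [M.tensor_coact_tmul N h hr, M'.tensor_coact_tmul N' h hr,
      map_tmul, sweedler_sweedler, sweedler_pure, hf.sweedler_coact, hf'.sweedler_coact]

theorem IsHom.conj (g : G) {p s : G} {M M' : YDData H p} (h : g * p * g⁻¹ = s)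
    {f : M.carrier →ₗ[k] M'.carrier} (hf : IsHom M M' f) :
    IsHom (M.conj g h) (M'.conj g h) f := by
  refine .of_sweedler hf.map_μ (fun a m => hf.map_act _ m) fun r m => ?_
  have hr : g * (g⁻¹ * r * g) * g⁻¹ = r := by group
  simp (disch := fun_prop) only [M.conj_coact g h hr, M'.conj_coact g h hr, sweedler_sweedler,
    sweedler_pure, hf.sweedler_coact]

theorem assocMap_tmul {p q s : G} (M : YDData H p) (N : YDData H q) (L : YDData H s)
    (m : M.carrier) (n : N.carrier) (l : L.carrier) :
    assocMap M N L ((m ⊗ₜ n) ⊗ₜ l) = M.μ m ⊗ₜ (n ⊗ₜ L.μ.symm l) := rfl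

theorem leftUnitorMap_tmul {p : G} (M : YDData H p) (x : k) (m : M.carrier) :
    leftUnitorMap M (x ⊗ₜ m) = x • M.μ m := by
  simp [leftUnitorMap]

theorem rightUnitorMap_tmul {p : G} (M : YDData H p) (x : k) (m : M.carrier) :
    rightUnitorMap M (m ⊗ₜ x) = x • M.μ m := by
  simp [rightUnitorMap]

theorem isHom_assocMap {p q r s t d : G} {M : YDData H p} {N : YDData H q} {L : YDData H r}
    (h₁ : p * q = s) (h₂ : s * r = d) (h₃ : q * r = t) (h₄ : p * t = d)
    (hM : M.IsYD) (hL : L.IsYD) :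
    IsHom ((M.tensor N h₁).tensor L h₂) (M.tensor (N.tensor L h₃) h₄)
      (assocMap M N L).toLinearMap := by
  refine .of_sweedler ?_ ?_ ?_
  · refine eq_of_tmul fun x l => ?_
    revert x
    refine eq_of_tmul fun m n => ?_
    simp only [LinearEquiv.coe_coe, congr_tmul, assocMap_tmul, LinearEquiv.symm_apply_apply,
      LinearEquiv.apply_symm_apply]
  · intro a
    refine eq_of_tmul fun x l => ?_
    revert x
    refine eq_of_tmul fun m n => ?_
    simp (disch := fun_prop) only [LinearEquiv.coe_coe, (M.tensor N h₁).tensor_act_tmul L h₂,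
      M.tensor_act_tmul N h₁, M.tensor_act_tmul (N.tensor L h₃) h₄, N.tensor_act_tmul L h₃,
      apply_sweedler, assocMap_tmul, sweedler_tmul_left, sweedler_tmul_right, hM.μ_act,
      hL.μ_symm_act]
    rw [H.sweedler_coassoc h₁ h₃ h₄ h₂ a (by fun_prop) (by fun_prop) (by fun_prop)]
    simp only [LinearEquiv.symm_apply_apply, LinearEquiv.apply_symm_apply]
  · intro u
    refine eq_of_tmul fun x l => ?_
    revert x
    refine eq_of_tmul fun m n => ?_
    obtain ⟨w₁, hw₁⟩ : ∃ w, r⁻¹ * w * r⁻¹⁻¹ = u := ⟨r * u * r⁻¹, by group⟩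
    obtain ⟨w₂, hw₂⟩ : ∃ w, q⁻¹ * w * q⁻¹⁻¹ = w₁ := ⟨q * w₁ * q⁻¹, by group⟩
    have hw₃ : t⁻¹ * w₂ * t⁻¹⁻¹ = u := by rw [← hw₁, ← hw₂, ← h₃]; group
    have e : r⁻¹ * q⁻¹ = t⁻¹ := by rw [← h₃]; group
    simp (disch := fun_prop) only [LinearEquiv.coe_coe, assocMap_tmul,
      (M.tensor N h₁).tensor_coact_tmul L h₂ hw₁, M.tensor_coact_tmul N h₁ hw₂,
      M.tensor_coact_tmul (N.tensor L h₃) h₄ hw₃, N.tensor_coact_tmul L h₃ hw₁,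
      sweedler_sweedler, sweedler_pure, hM.sweedler_μ, hL.sweedler_μ_symm, H.mul_mul, H.π_mul,
      H.π_π r⁻¹ q⁻¹ _ _ _ _ hw₂ hw₁ e, LinearEquiv.apply_symm_apply, LinearEquiv.symm_apply_apply,
      H.π_α]

theorem isHom_leftUnitorMap {p : G} {M : YDData H p} (hM : M.IsYD) :
    IsHom ((YDData.unit H).tensor M (one_mul p)) M (leftUnitorMap M).toLinearMap := by
  refine .of_sweedler ?_ ?_ ?_
  · refine eq_of_tmul fun x m => ?_
    simp only [LinearEquiv.coe_coe, congr_tmul, leftUnitorMap_tmul, LinearEquiv.refl_apply,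
      map_smul]
  · intro a
    refine eq_of_tmul fun x m => ?_
    simp only [LinearEquiv.coe_coe, (YDData.unit H).tensor_act_tmul M (one_mul p), apply_sweedler,
      leftUnitorMap_tmul]
    simp only [LinearMap.comp_apply, LinearMap.mul_apply', mul_smul]
    rw [H.sweedler_counit_left (one_mul p) a (f := fun b => x • M.μ (M.act b m)) (by fun_prop)]
    simp only [hM.μ_act, LinearEquiv.apply_symm_apply, map_smul]
  · intro r
    refine eq_of_tmul fun x m => ?_
    have hr : p⁻¹ * (p * r * p⁻¹) * p⁻¹⁻¹ = r := by group
    simp (disch := fun_prop) only [LinearEquiv.coe_coe, leftUnitorMap_tmul,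
      (YDData.unit H).tensor_coact_tmul M (one_mul p) hr, LinearMap.flip_apply, mk_apply,
      sweedler_sweedler, sweedler_pure, H.π_one, H.mul_one', map_smul]
    simp only [hM.coact_μ, map_eq_sweedler, smul_sweedler, smul_tmul', LinearEquiv.coe_coe]

theorem isHom_rightUnitorMap {p : G} {M : YDData H p} (hM : M.IsYD) :
    IsHom (M.tensor (YDData.unit H) (mul_one p)) M (rightUnitorMap M).toLinearMap := by
  refine .of_sweedler ?_ ?_ ?_
  · refine eq_of_tmul fun m x => ?_
    simp only [LinearEquiv.coe_coe, congr_tmul, rightUnitorMap_tmul, LinearEquiv.refl_apply,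
      map_smul]
  · intro a
    refine eq_of_tmul fun m x => ?_
    simp only [LinearEquiv.coe_coe, M.tensor_act_tmul (YDData.unit H) (mul_one p), apply_sweedler,
      rightUnitorMap_tmul]
    simp only [LinearMap.comp_apply, LinearMap.mul_apply', mul_smul]
    rw [H.sweedler_counit_right (mul_one p) a (f := fun b => x • M.μ (M.act b m)) (by fun_prop)]
    simp only [hM.μ_act, LinearEquiv.apply_symm_apply, map_smul]
  · intro r
    refine eq_of_tmul fun m x => ?_
    have hr : (1 : G)⁻¹ * r * 1⁻¹⁻¹ = r := by group
    simp (disch := fun_prop) only [LinearEquiv.coe_coe, rightUnitorMap_tmul,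
      M.tensor_coact_tmul (YDData.unit H) (mul_one p) hr, LinearMap.flip_apply, mk_apply,
      sweedler_sweedler, sweedler_pure, H.one_mul', H.π_eq_self _ _ _ inv_one, map_smul]
    simp only [hM.coact_μ, map_eq_sweedler, smul_sweedler, smul_tmul', LinearEquiv.coe_coe]

end YDData

end YDMorphisms

section YDBraiding

open TensorProduct

variable {k : Type u} [Field k] {G : Type v} [Group G] {H : HomHopfTCoalgebra.{u, v, w} k G}

namespace YDData

/-! ### The braiding -/

variable {p q : G}

theorem braidMap_tmul (M : YDData H p) (N : YDData H q) (m : M.carrier) (n : N.carrier) :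
    braidMap M N (m ⊗ₜ n) = sweedler (M.coact q⁻¹ m) fun x a =>
      N.act (H.S q⁻¹ q (inv_mul_cancel q) a) (N.μ.symm n) ⊗ₜ M.μ x := by
  simp only [braidMap, LinearMap.comp_apply, map_tmul, LinearEquiv.coe_coe]
  generalize M.coact q⁻¹ m = t
  revert t
  refine eq_of_tmul fun x a => ?_
  simp (disch := fun_prop) only [sweedler_pure, assoc_tmul, map_tmul, comm_tmul, lift.tmul,
    LinearEquiv.coe_coe, LinearMap.comp_apply]

/-- The inverse `n ⊗ m ↦ μ(m₀) ⊗ m_{(1,q)} · ν⁻¹(n)` of the braiding `c_{M,N}`, where `N` has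
degree `q`. -/
noncomputable def braidInv (M : YDData H p) (N : YDData H q) :
    N.carrier ⊗[k] M.carrier →ₗ[k] M.carrier ⊗[k] N.carrier :=
  map M.μ.toLinearMap (lift N.act) ∘ₗ
    (TensorProduct.assoc k M.carrier (H.obj q) N.carrier).toLinearMap ∘ₗ
    map (M.coact q) N.μ.symm.toLinearMap ∘ₗ
    (TensorProduct.comm k N.carrier M.carrier).toLinearMap

theorem braidInv_tmul (M : YDData H p) (N : YDData H q) (n : N.carrier) (m : M.carrier) :
    braidInv M N (n ⊗ₜ m) = sweedler (M.coact q m) fun x a =>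
      M.μ x ⊗ₜ N.act a (N.μ.symm n) := by
  simp only [braidInv, LinearMap.comp_apply, map_tmul, comm_tmul, LinearEquiv.coe_coe]
  generalize M.coact q m = t
  revert t
  refine eq_of_tmul fun x a => ?_
  simp (disch := fun_prop) only [sweedler_pure, assoc_tmul, map_tmul, lift.tmul,
    LinearEquiv.coe_coe]

/-- The antipode identity `S(h₁) h₂ = ε(h) 1`, applied to `h = m_{(1,e)}`. -/
theorem braidMap_braidInv {M : YDData H p} {N : YDData H q} (hM : M.IsYD) (hN : N.IsYD) :
    ∀ x, braidMap M N (braidInv M N x) = x := by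
  refine eq_of_tmul fun n m => ?_
  simp (disch := fun_prop) only [braidInv_tmul, apply_sweedler, braidMap_tmul, hM.sweedler_μ]
  rw [hM.sweedler_coassoc (inv_mul_cancel q) m (by fun_prop) (by fun_prop) (by fun_prop)]
  simp only [H.S_α, hN.μ_symm_act, hN.act_act, LinearEquiv.symm_apply_apply,
    LinearEquiv.apply_symm_apply]
  have h (x : M.carrier) (y : H.obj 1) := H.sweedler_S_left q q⁻¹ (inv_mul_cancel q) y
    (f := fun b => N.act b (N.μ.symm n) ⊗ₜ[k] M.μ x) (by fun_prop)
  simp only [h, hN.one_act, LinearEquiv.apply_symm_apply]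
  rw [hM.sweedler_counit m (f := fun x => n ⊗ₜ[k] M.μ x) (by fun_prop),
    LinearEquiv.apply_symm_apply]

/-- The antipode identity `h₁ S(h₂) = ε(h) 1`, applied to `h = m_{(1,e)}`. -/
theorem braidInv_braidMap {M : YDData H p} {N : YDData H q} (hM : M.IsYD) (hN : N.IsYD) :
    ∀ x, braidInv M N (braidMap M N x) = x := by
  refine eq_of_tmul fun m n => ?_
  simp (disch := fun_prop) only [braidInv_tmul, apply_sweedler, braidMap_tmul, hM.sweedler_μ]
  rw [hM.sweedler_coassoc (mul_inv_cancel q) m (by fun_prop) (by fun_prop) (by fun_prop)]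
  simp only [H.S_α, hN.μ_symm_act, hN.act_act, LinearEquiv.symm_apply_apply,
    LinearEquiv.apply_symm_apply]
  have h (x : M.carrier) (y : H.obj 1) := H.sweedler_S_right q q⁻¹ (inv_mul_cancel q)
    (mul_inv_cancel q) y (f := fun b => M.μ x ⊗ₜ[k] N.act b (N.μ.symm n)) (by fun_prop)
  simp only [h, hN.one_act, LinearEquiv.apply_symm_apply]
  rw [hM.sweedler_counit m (f := fun x => M.μ x ⊗ₜ[k] n) (by fun_prop),
    LinearEquiv.apply_symm_apply]

/-- `braidInv` as a linear equivalence; its inverse is the braiding. -/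
noncomputable def braidEquiv {M : YDData H p} {N : YDData H q} (hM : M.IsYD) (hN : N.IsYD) :
    N.carrier ⊗[k] M.carrier ≃ₗ[k] M.carrier ⊗[k] N.carrier :=
  LinearEquiv.ofLinearMap (braidInv M N) (braidMap M N) (LinearMap.ext (braidInv_braidMap hM hN))
    (LinearMap.ext (braidMap_braidInv hM hN))

/-- The inverse braiding is a morphism: it is linear over `H` by the compatibility condition for
`M`, and colinear by the one for `N`.  The antipode does not occur here. -/
theorem isHom_braidInv {s t : G} {M : YDData H p} {N : YDData H q} (h₁ : p * q = s)
    (h₂ : p * q * p⁻¹ = t) (h₃ : t * p = s) (hM : M.IsYD) (hN : N.IsYD) :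
    IsHom ((N.conj p h₂).tensor M h₃) (M.tensor N h₁) (braidInv M N) := by
  have h₄ : p⁻¹ * t * p⁻¹⁻¹ = q := by rw [← h₂]; group
  refine .of_sweedler ?_ ?_ ?_
  · refine eq_of_tmul fun n m => ?_
    simp (disch := fun_prop) only [congr_tmul, braidInv_tmul, hM.sweedler_μ, apply_sweedler,
      hN.μ_act, LinearEquiv.apply_symm_apply, LinearEquiv.symm_apply_apply]
  · intro c
    refine eq_of_tmul fun n m => ?_
    simp (disch := fun_prop) only [(N.conj p h₂).tensor_act_tmul M h₃, M.tensor_act_tmul N h₁,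
      apply_sweedler, braidInv_tmul]
    simp only [LinearMap.comp_apply, hN.μ_symm_act, hN.act_act, LinearEquiv.apply_symm_apply,
      ← H.α_symm_mul]
    have e := hM.sweedler_compat h₁ h₃ h₄ c (M.μ m)
      (f := fun x z => x ⊗ₜ[k] N.act ((H.α q).symm z) n) (by fun_prop) (by fun_prop)
    simp (disch := fun_prop) only [hM.sweedler_μ, H.α_symm_mul, LinearEquiv.symm_apply_apply] at e
    simp only [← H.α_symm_mul] at e
    exact e.symm.trans (sweedler_comm ..)
  · intro r
    refine eq_of_tmul fun n m => ?_
    have hr₁ : p * r * p⁻¹ = p * r * p⁻¹ := rfl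
    have hr₂ : p⁻¹ * (p * r * p⁻¹) * p⁻¹⁻¹ = r := by group
    have hr₃ : q⁻¹ * (q * r * q⁻¹) * q⁻¹⁻¹ = r := by group
    have hqr : (q * r * q⁻¹) * q = q * r := by group
    simp (disch := fun_prop) only [(N.conj p h₂).tensor_coact_tmul M h₃ hr₂,
      M.tensor_coact_tmul N h₁ hr₃, N.conj_coact p h₂ hr₁, apply_sweedler, braidInv_tmul,
      sweedler_sweedler, sweedler_pure, hM.sweedler_μ, H.π_inv_π, sweedler_tmul_left]
    rw [hM.sweedler_coassoc hqr m (by fun_prop) (by fun_prop) (by fun_prop)]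
    simp (disch := fun_prop) only [hM.sweedler_coassoc (show q * r = q * r from rfl),
      LinearEquiv.apply_symm_apply]
    refine (sweedler_congr fun x z => ?_).trans (sweedler_comm ..)
    have e := hN.sweedler_compat rfl hqr hr₃ (H.α (q * r) z) n
      (f := fun x' y => x ⊗ₜ[k] N.μ.symm x' ⊗ₜ[k] y) (by fun_prop) (by fun_prop)
    simp (disch := fun_prop) only [H.sweedler_comul_α, LinearEquiv.symm_apply_apply,
      hN.μ_symm_act] at e
    rw [← e]
    exact sweedler_comm ..

theorem isHom_braidMap {s t : G} {M : YDData H p} {N : YDData H q} (h₁ : p * q = s)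
    (h₂ : p * q * p⁻¹ = t) (h₃ : t * p = s) (hM : M.IsYD) (hN : N.IsYD) :
    IsHom (M.tensor N h₁) ((N.conj p h₂).tensor M h₃) (braidMap M N) :=
  IsHom.symm (M := (N.conj p h₂).tensor M h₃) (N := M.tensor N h₁)
    (e := braidEquiv (M := M) (N := N) hM hN)
    (isHom_braidInv h₁ h₂ h₃ hM hN)

end YDData

end YDBraiding

section YDHexagons

open TensorProduct

variable {k : Type u} [Field k] {G : Type v} [Group G] {H : HomHopfTCoalgebra.{u, v, w} k G}

namespace YDData

/-! ### Naturality of the braiding, and the hexagon identities -/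

variable {p q r : G}

theorem assocMap_symm_tmul (M : YDData H p) (N : YDData H q) (L : YDData H r)
    (m : M.carrier) (n : N.carrier) (l : L.carrier) :
    (assocMap M N L).symm (m ⊗ₜ (n ⊗ₜ l)) = (M.μ.symm m ⊗ₜ n) ⊗ₜ L.μ l := rfl

theorem braidMap_map {M M' : YDData H p} {N N' : YDData H q} {f : M.carrier →ₗ[k] M'.carrier}
    {f' : N.carrier →ₗ[k] N'.carrier} (hf : IsHom M M' f) (hf' : IsHom N N' f') :
    ∀ x, map f' f (braidMap M N x) = braidMap M' N' (map f f' x) := by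
  have h (n : N.carrier) : f' (N.μ.symm n) = N'.μ.symm (f' n) := by
    rw [LinearEquiv.eq_symm_apply, ← hf'.map_μ, LinearEquiv.apply_symm_apply]
  refine eq_of_tmul fun m n => ?_
  simp (disch := fun_prop) only [braidMap_tmul, apply_sweedler, map_tmul, hf.sweedler_coact, h,
    hf.map_μ, hf'.map_act]

/-- Maps with equal inverses are equal. -/
theorem eq_of_inverse_eq {A B : Type*} {f g : A → B} {f' g' : B → A}
    (hf : ∀ x, f' (f x) = x) (hg : ∀ y, g (g' y) = y) (h : ∀ y, f' y = g' y) (x : A) :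
    f x = g x := by
  rw [← hg (f x), ← h, hf]

/-- Conjugation does not change the braiding; this is read off from the inverses. -/
theorem braidMap_conj (g : G) {p' q' : G} {M : YDData H p} {N : YDData H q}
    (hp : g * p * g⁻¹ = p') (hq : g * q * g⁻¹ = q') (hM : M.IsYD) (hN : N.IsYD) :
    ∀ x, braidMap M N x = braidMap (M.conj g hp) (N.conj g hq) x := by
  refine eq_of_inverse_eq (f' := braidInv M N) (g' := braidInv (M.conj g hp) (N.conj g hq))
    (braidInv_braidMap hM hN) (braidMap_braidInv (hM.conj g hp) (hN.conj g hq)) ?_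
  refine eq_of_tmul fun n m => ?_
  refine (braidInv_tmul M N n m).trans
    (Eq.trans ?_ (braidInv_tmul (M.conj g hp) (N.conj g hq) n m).symm)
  simp (disch := fun_prop) only [M.conj_coact g hp hq, sweedler_sweedler, sweedler_pure,
    LinearMap.comp_apply, H.π_inv_π]

/-- The first hexagon identity.  For the inverses it is the coassociativity of the coaction
of `M`. -/
theorem hexagon_left {t : G} {M : YDData H p} {N : YDData H q} {L : YDData H r} (h : q * r = t)
    (hM : M.IsYD) (hN : N.IsYD) (hL : L.IsYD) (x : (M.carrier ⊗[k] N.carrier) ⊗[k] L.carrier) :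
    map LinearMap.id (braidMap M L) (assocMap N M L (map (braidMap M N) LinearMap.id x)) =
      assocMap N L M (braidMap M (N.tensor L h) (assocMap M N L x)) := by
  have hNL := hN.tensor h hL
  refine eq_of_inverse_eq
    (f := fun x => map LinearMap.id (braidMap M L)
      (assocMap N M L (map (braidMap M N) LinearMap.id x)))
    (g := fun x => assocMap N L M (braidMap M (N.tensor L h) (assocMap M N L x)))
    (f' := fun y => map (braidInv M N) LinearMap.id
      ((assocMap N M L).symm (map LinearMap.id (braidInv M L) y)))
    (g' := fun y => (assocMap M N L).symm
      (braidInv M (N.tensor L h) ((assocMap N L M).symm y))) ?_ ?_ ?_ x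
  · intro x
    have h₁ : ∀ z, map LinearMap.id (braidInv M L)
        (map (LinearMap.id : N.carrier →ₗ[k] N.carrier) (braidMap M L) z) = z :=
      eq_of_tmul fun n z => by simp only [map_tmul, braidInv_braidMap hM hL, LinearMap.id_apply]
    have h₂ : ∀ z, map (braidInv M N) LinearMap.id
        (map (braidMap M N) (LinearMap.id : L.carrier →ₗ[k] L.carrier) z) = z :=
      eq_of_tmul fun z l => by simp only [map_tmul, braidInv_braidMap hM hN, LinearMap.id_apply]
    simp only [h₁, h₂, LinearEquiv.symm_apply_apply]
  · intro y
    simp only [LinearEquiv.apply_symm_apply, braidMap_braidInv hM hNL]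
  · refine eq_of_tmul fun n y => ?_
    revert y
    refine eq_of_tmul fun l m => ?_
    simp (disch := fun_prop) only [map_tmul, braidInv_tmul, assocMap_symm_tmul, apply_sweedler,
      sweedler_tmul_right, sweedler_tmul_left, LinearMap.id_apply, hM.sweedler_μ]
    rw [hM.sweedler_coassoc h m (by fun_prop) (by fun_prop) (by fun_prop)]
    refine Eq.trans ?_ (congrArg (assocMap M N L).symm
      (M.braidInv_tmul (N.tensor L h) (N.μ.symm n ⊗ₜ l) (M.μ m))).symm
    simp (disch := fun_prop) only [hM.sweedler_μ, congr_symm_tmul, N.tensor_act_tmul L h,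
      sweedler_tmul_right, apply_sweedler, assocMap_symm_tmul, H.sweedler_comul_α,
      LinearEquiv.symm_apply_apply, LinearEquiv.apply_symm_apply, hL.μ_act]

/-- The second hexagon identity.  For the inverses it is the associativity of the action on `L`. -/
theorem hexagon_right {s r' : G} {M : YDData H p} {N : YDData H q} {L : YDData H r} (h : p * q = s)
    (hr : q * r * q⁻¹ = r')
    (hM : M.IsYD) (hN : N.IsYD) (hL : L.IsYD) (x : M.carrier ⊗[k] (N.carrier ⊗[k] L.carrier)) :
    (assocMap L M N).symm (braidMap (M.tensor N h) L ((assocMap M N L).symm x)) =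
      map (braidMap M (L.conj q hr)) LinearMap.id
        ((assocMap M L N).symm (map LinearMap.id (braidMap N L) x)) := by
  have hMN := hM.tensor h hN
  have hL' := hL.conj q hr
  refine eq_of_inverse_eq
    (f := fun x => (assocMap L M N).symm (braidMap (M.tensor N h) L ((assocMap M N L).symm x)))
    (g := fun x => map (braidMap M (L.conj q hr)) LinearMap.id
      ((assocMap M L N).symm (map LinearMap.id (braidMap N L) x)))
    (f' := fun y => assocMap M N L (braidInv (M.tensor N h) L (assocMap L M N y)))
    (g' := fun y => map LinearMap.id (braidInv N L)
      (assocMap M L N (map (braidInv M (L.conj q hr)) LinearMap.id y))) ?_ ?_ ?_ x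
  · intro x
    simp only [LinearEquiv.apply_symm_apply, braidInv_braidMap hMN hL]
  · intro y
    have h₁ : ∀ z, map LinearMap.id (braidMap N L)
        (map (LinearMap.id : M.carrier →ₗ[k] M.carrier) (braidInv N L) z) = z :=
      eq_of_tmul fun n z => by simp only [map_tmul, braidMap_braidInv hN hL, LinearMap.id_apply]
    have h₂ : ∀ z, map (braidMap M (L.conj q hr)) LinearMap.id
        (map (braidInv M (L.conj q hr)) (LinearMap.id : N.carrier →ₗ[k] N.carrier) z) = z :=
      eq_of_tmul fun z l => by simp only [map_tmul, braidMap_braidInv hM hL', LinearMap.id_apply]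
    simp only [h₁, h₂, LinearEquiv.symm_apply_apply]
  · refine eq_of_tmul fun y n => ?_
    revert y
    refine eq_of_tmul fun l m => ?_
    have hr' : q⁻¹ * r' * q⁻¹⁻¹ = r := by rw [← hr]; group
    simp (disch := fun_prop) only [map_tmul, braidInv_tmul, assocMap_tmul, apply_sweedler,
      sweedler_tmul_right, sweedler_tmul_left, LinearMap.id_apply, M.braidInv_tmul (L.conj q hr)]
    refine (congrArg (assocMap M N L)
      ((M.tensor N h).braidInv_tmul L (L.μ l) (m ⊗ₜ N.μ.symm n))).trans ?_
    simp (disch := fun_prop) only [M.tensor_coact_tmul N h hr', sweedler_sweedler, sweedler_pure,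
      congr_tmul, apply_sweedler, assocMap_tmul, hN.sweedler_μ_symm, LinearMap.comp_apply,
      hL.μ_symm_act, hL.act_act, LinearEquiv.symm_apply_apply, LinearEquiv.apply_symm_apply,
      H.α_symm_mul]

end YDData

end YDHexagons

section YDCategory

open TensorProduct

variable {k : Type u} [Field k] {G : Type v} [Group G] {H : HomHopfTCoalgebra.{u, v, w} k G}

namespace YDData

/-! ### Equalities between conjugates and tensor products -/

/-- Equality of two data with the same underlying space and automorphism. -/
theorem mk_congr {p : G} {C : Type u} [AddCommGroup C] [Module k C] {μ : C ≃ₗ[k] C}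
    {act act' : H.obj p →ₗ[k] C →ₗ[k] C} {coact coact' : ∀ r : G, C →ₗ[k] C ⊗[k] H.obj r}
    (h : ∀ a m, act a m = act' a m) (h' : ∀ r m, coact r m = coact' r m) :
    (⟨C, μ, act, coact⟩ : YDData H p) = ⟨C, μ, act', coact'⟩ := by
  obtain rfl : act = act' := LinearMap.ext fun a => LinearMap.ext (h a)
  obtain rfl : coact = coact' := funext fun r => LinearMap.ext (h' r)
  rfl

theorem conj_one {p : G} (M : YDData H p) (h : 1 * p * 1⁻¹ = p) : M.conj 1 h = M := by
  refine mk_congr (act' := M.act) (coact' := M.coact) (fun a m => ?_) fun r m => ?_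
  · rw [LinearMap.comp_apply, H.π_eq_self _ _ _ inv_one]
  · have hr : 1 * r * 1⁻¹ = r := by group
    refine (M.conj_coact 1 h hr m).trans ?_
    simp only [H.π_id, sweedler_tmul]

theorem conj_conj (g g' : G) {p q s : G} (M : YDData H p) (h : g' * p * g'⁻¹ = q)
    (h' : g * q * g⁻¹ = s) (h'' : g * g' * p * (g * g')⁻¹ = s) :
    M.conj (g * g') h'' = (M.conj g' h).conj g h' := by
  refine mk_congr (fun a m => ?_) fun r m => ?_
  · simp only [LinearMap.comp_apply]
    rw [H.π_π g'⁻¹ g⁻¹ _ _ _ _ _ _ (mul_inv_rev g g').symm]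
  · obtain ⟨u, hu⟩ : ∃ u, g * u * g⁻¹ = r := ⟨g⁻¹ * r * g, by group⟩
    obtain ⟨v, hv⟩ : ∃ v, g' * v * g'⁻¹ = u := ⟨g'⁻¹ * u * g', by group⟩
    have hr : g * g' * v * (g * g')⁻¹ = r := by rw [← hu, ← hv]; group
    refine (M.conj_coact (g * g') h'' hr m).trans
      (Eq.trans ?_ ((M.conj g' h).conj_coact g h' hu m).symm)
    simp (disch := fun_prop) only [M.conj_coact g' h hv, sweedler_sweedler, sweedler_pure,
      H.π_π g g' _ _ _ _ hv hu rfl]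

theorem conj_unit (g : G) (h : g * 1 * g⁻¹ = 1) : (YDData.unit H).conj g h = YDData.unit H := by
  refine mk_congr (fun a m => ?_) fun r m => ?_
  · simp only [LinearMap.comp_apply, H.counit_π]
  · have hr : g * (g⁻¹ * r * g) * g⁻¹ = r := by group
    refine ((YDData.unit H).conj_coact g h hr m).trans ?_
    simp (disch := fun_prop) only [LinearMap.flip_apply, mk_apply, sweedler_pure, H.π_one]

theorem conj_tensor (g : G) {p q s p' q' s' : G} (M : YDData H p) (N : YDData H q)
    (h : p * q = s) (hs : g * s * g⁻¹ = s') (hp : g * p * g⁻¹ = p') (hq : g * q * g⁻¹ = q')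
    (h' : p' * q' = s') :
    (M.tensor N h).conj g hs = (M.conj g hp).tensor (N.conj g hq) h' := by
  refine mk_congr (fun c => eq_of_tmul fun m n => ?_) fun r => eq_of_tmul fun m n => ?_
  · have hp' : g⁻¹ * p' * g⁻¹⁻¹ = p := by rw [← hp]; group
    have hq' : g⁻¹ * q' * g⁻¹⁻¹ = q := by rw [← hq]; group
    have hs' : g⁻¹ * s' * g⁻¹⁻¹ = s := by rw [← hs]; group
    refine (M.tensor_act_tmul N h (H.π g⁻¹ s' s hs' c) m n).trans
      (Eq.trans ?_ ((M.conj g hp).tensor_act_tmul (N.conj g hq) h' c m n).symm)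
    simp (disch := fun_prop) only [H.sweedler_comul_π g⁻¹ h' h hp' hq' hs', LinearMap.comp_apply]
  · obtain ⟨r', hr⟩ : ∃ r', g * r' * g⁻¹ = r := ⟨g⁻¹ * r * g, by group⟩
    have hr₁ : q⁻¹ * (q * r' * q⁻¹) * q⁻¹⁻¹ = r' := by group
    have hr₂ : q'⁻¹ * (q' * r * q'⁻¹) * q'⁻¹⁻¹ = r := by group
    have hr₃ : g * (q * r' * q⁻¹) * g⁻¹ = q' * r * q'⁻¹ := by rw [← hq, ← hr]; group
    have e : q'⁻¹ * g = g * q⁻¹ := by rw [← hq]; group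
    refine ((M.tensor N h).conj_coact g hs hr (m ⊗ₜ n)).trans
      (Eq.trans ?_ ((M.conj g hp).tensor_coact_tmul (N.conj g hq) h' hr₂ m n).symm)
    simp (disch := fun_prop) only [M.tensor_coact_tmul N h hr₁, M.conj_coact g hp hr₃,
      N.conj_coact g hq hr, sweedler_sweedler, sweedler_pure, H.π_mul,
      H.π_π g q⁻¹ _ _ _ _ hr₁ hr rfl, H.π_π q'⁻¹ g _ _ _ _ hr₃ hr₂ e]

end YDData

theorem ydWellDefined (H : HomHopfTCoalgebra.{u, v, w} k G) : YDWellDefined H where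
  unit := .unit
  tensor _ _ h hM hN := hM.tensor h hN
  conj g _ _ _ h hM := hM.conj g h
  tensorHom _ _ _ _ h _ _ _ _ _ _ hf hf' := hf.tensor h hf'
  conjHom g _ _ _ _ h _ _ _ hf := hf.conj g h
  associator _ _ _ h₁ h₂ h₃ h₄ hM _ hL := YDData.isHom_assocMap h₁ h₂ h₃ h₄ hM hL
  leftUnitor _ hM := YDData.isHom_leftUnitorMap hM
  rightUnitor _ hM := YDData.isHom_rightUnitorMap hM
  braid _ _ h₁ h₂ h₃ hM hN := YDData.isHom_braidMap h₁ h₂ h₃ hM hN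

open CategoryTheory MonoidalCategory

namespace YD

/-! ### The linear map underlying a morphism -/

/-- The linear map underlying a morphism of Yetter-Drinfeld modules. -/
def lin : ∀ {X Y : YD H}, (X ⟶ Y) → (X.2.data.carrier →ₗ[k] Y.2.data.carrier)
  | ⟨_, _⟩, ⟨_, _⟩, .mk f => f.lin

/-- Taking the underlying linear map is faithful. -/
theorem hom_ext {X Y : YD H} {f g : X ⟶ Y} (h : lin f = lin g) : f = g := by
  obtain ⟨p, M⟩ := X
  obtain ⟨f⟩ := f
  obtain ⟨g⟩ := g
  exact congrArg _ (YDMod.Hom.ext h)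

theorem lin_id (X : YD H) : lin (𝟙 X) = LinearMap.id := rfl

theorem lin_comp {X Y Z : YD H} (f : X ⟶ Y) (g : Y ⟶ Z) : lin (f ≫ g) = lin g ∘ₗ lin f := by
  obtain ⟨f⟩ := f
  obtain ⟨g⟩ := g
  rfl

/-- The map underlying the morphism given by an equality of objects is a cast; when the underlying
spaces of the two objects agree definitionally, the cast is by definition the identity. -/
theorem lin_eqToHom {X Y : YD H} (e : X = Y) (x : X.2.data.carrier) :
    lin (eqToHom e) x = cast (congrArg (fun Z : YD H => Z.2.data.carrier) e) x := by
  subst e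
  rfl

theorem isIso_of_bijective {X Y : YD H} (f : X ⟶ Y) (hf : Function.Bijective (lin f)) :
    IsIso f := by
  obtain ⟨p, M⟩ := X
  obtain ⟨f⟩ := f
  exact ((Sigma.incl p).mapIso (mkIso (.ofBijective f.lin hf) f.isHom)).isIso_hom

theorem mk_data_congr {p : G} {M N : YDMod H p} (h : M.data = N.data) :
    (⟨p, M⟩ : YD H) = ⟨p, N⟩ := by
  obtain ⟨M, hM⟩ := M
  obtain ⟨N, hN⟩ := N
  subst h
  rfl

/-- The structure maps of the category of Yetter-Drinfeld modules. -/
noncomputable abbrev struct (H : HomHopfTCoalgebra.{u, v, w} k G) : TCategoryStruct G (YD H) :=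
  tCategoryStruct (ydWellDefined H)

/-- The tensor structure contained in `struct H`. -/
noncomputable instance : MonoidalCategoryStruct (YD H) := (struct H).toMonoidalCategoryStruct

/-! ### The linear maps underlying the structure maps -/

variable {X X' Y Y' Z : YD H}

theorem lin_comp_eq {f : X ⟶ Y} {g : Y ⟶ Z} {φ : X.2.data.carrier →ₗ[k] Y.2.data.carrier}
    {ψ : Y.2.data.carrier →ₗ[k] Z.2.data.carrier} (hf : lin f = φ) (hg : lin g = ψ) :
    lin (f ≫ g) = ψ ∘ₗ φ := by
  rw [lin_comp, hf, hg]

theorem lin_tensorHom_eq {f : X ⟶ X'} {g : Y ⟶ Y'} {φ : X.2.data.carrier →ₗ[k] X'.2.data.carrier}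
    {ψ : Y.2.data.carrier →ₗ[k] Y'.2.data.carrier} (hf : lin f = φ) (hg : lin g = ψ) :
    lin (f ⊗ₘ g) = TensorProduct.map φ ψ := by
  subst hf hg
  obtain ⟨f⟩ := f
  obtain ⟨g⟩ := g
  rfl

theorem lin_whiskerLeft_eq (X : YD H) {g : Y ⟶ Y'}
    {ψ : Y.2.data.carrier →ₗ[k] Y'.2.data.carrier} (hg : lin g = ψ) :
    lin (X ◁ g) = TensorProduct.map LinearMap.id ψ :=
  lin_tensorHom_eq (lin_id X) hg

theorem lin_whiskerRight_eq {f : X ⟶ X'} {φ : X.2.data.carrier →ₗ[k] X'.2.data.carrier}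
    (hf : lin f = φ) (Y : YD H) :
    lin (f ▷ Y) = TensorProduct.map φ LinearMap.id :=
  lin_tensorHom_eq hf (lin_id Y)

theorem lin_associator_hom (X Y Z : YD H) :
    lin (α_ X Y Z).hom = (YDData.assocMap X.2.data Y.2.data Z.2.data).toLinearMap := by
  have e := tensorObj_eq (ydWellDefined H) X.2 (tensorMod (ydWellDefined H) Y.2 Z.2 rfl)
    (mul_assoc X.1 Y.1 Z.1).symm
  exact (lin_comp (X := (X ⊗ Y) ⊗ Z) (Z := X ⊗ (Y ⊗ Z)) _ (eqToHom e)).trans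
    (LinearMap.ext fun x => lin_eqToHom e _)

theorem lin_associator_inv (X Y Z : YD H) :
    lin (α_ X Y Z).inv = (YDData.assocMap X.2.data Y.2.data Z.2.data).symm.toLinearMap := by
  have e := tensorObj_eq (ydWellDefined H) X.2 (tensorMod (ydWellDefined H) Y.2 Z.2 rfl)
    (mul_assoc X.1 Y.1 Z.1).symm
  exact (lin_comp (X := X ⊗ (Y ⊗ Z)) (Z := (X ⊗ Y) ⊗ Z) (eqToHom e.symm) _).trans
    (LinearMap.ext fun x => congrArg (YDData.assocMap X.2.data Y.2.data Z.2.data).symm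
      (lin_eqToHom e.symm x))

theorem lin_leftUnitor_hom (X : YD H) :
    lin (λ_ X).hom = (YDData.leftUnitorMap X.2.data).toLinearMap := by
  have e := tensorObj_eq (ydWellDefined H) (unitMod (ydWellDefined H)) X.2 (one_mul X.1)
  exact (lin_comp (X := 𝟙_ _ ⊗ X) (Z := X) (eqToHom e.symm) _).trans
    (LinearMap.ext fun x => congrArg (YDData.leftUnitorMap X.2.data) (lin_eqToHom e.symm x))

theorem lin_rightUnitor_hom (X : YD H) :
    lin (ρ_ X).hom = (YDData.rightUnitorMap X.2.data).toLinearMap := by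
  have e := tensorObj_eq (ydWellDefined H) X.2 (unitMod (ydWellDefined H)) (mul_one X.1)
  exact (lin_comp (X := X ⊗ 𝟙_ _) (Z := X) (eqToHom e.symm) _).trans
    (LinearMap.ext fun x => congrArg (YDData.rightUnitorMap X.2.data) (lin_eqToHom e.symm x))

theorem lin_conj_map (g : G) (f : X ⟶ Y) : lin (((struct H).conj g).map f) = lin f := by
  obtain ⟨f⟩ := f
  rfl

theorem lin_braid (X Y : YD H) :
    lin ((struct H).braid X Y) = YDData.braidMap X.2.data Y.2.data := by
  have e := tensorObj_eq (ydWellDefined H) (conjMod (ydWellDefined H) X.1 Y.2 rfl) X.2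
    (inv_mul_cancel_right (X.1 * Y.1) X.1)
  exact (lin_comp (X := X ⊗ Y) (Z := ((struct H).conj X.1).obj Y ⊗ X) _ (eqToHom e)).trans
    (LinearMap.ext fun x => lin_eqToHom e _)

theorem lin_μ (f : X ⟶ Y) (x : X.2.data.carrier) :
    lin f (X.2.data.μ x) = Y.2.data.μ (lin f x) := by
  obtain ⟨f⟩ := f
  exact f.isHom.map_μ x

end YD

end YDCategory

section YDBraided

open TensorProduct CategoryTheory MonoidalCategory

variable {k : Type u} [Field k] {G : Type v} [Group G] {H : HomHopfTCoalgebra.{u, v, w} k G}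

namespace YDData

/-! ### Coherence of the associator and the unitors -/

variable {p p' q q' r r' s : G}

theorem assocMap_map {M : YDData H p} {M' : YDData H p'} {N : YDData H q} {N' : YDData H q'}
    {L : YDData H r} {L' : YDData H r'} {f : M.carrier →ₗ[k] M'.carrier}
    (f' : N.carrier →ₗ[k] N'.carrier) {f'' : L.carrier →ₗ[k] L'.carrier}
    (hf : ∀ m, f (M.μ m) = M'.μ (f m)) (hf'' : ∀ l, f'' (L.μ l) = L'.μ (f'' l)) :
    (assocMap M' N' L').toLinearMap ∘ₗ map (map f f') f'' =
      map f (map f' f'') ∘ₗ (assocMap M N L).toLinearMap := by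
  refine TensorProduct.ext_threefold fun m n l => ?_
  have h : f'' (L.μ.symm l) = L'.μ.symm (f'' l) := by
    rw [LinearEquiv.eq_symm_apply, ← hf'', LinearEquiv.apply_symm_apply]
  simp only [LinearMap.comp_apply, map_tmul, LinearEquiv.coe_coe, assocMap_tmul, hf, h]

theorem leftUnitorMap_map {M : YDData H p} {M' : YDData H p'} {f : M.carrier →ₗ[k] M'.carrier}
    (hf : ∀ m, f (M.μ m) = M'.μ (f m)) :
    (leftUnitorMap M').toLinearMap ∘ₗ map LinearMap.id f =
      f ∘ₗ (leftUnitorMap M).toLinearMap := by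
  refine TensorProduct.ext' fun x m => ?_
  simp only [LinearMap.comp_apply, map_tmul, LinearEquiv.coe_coe, leftUnitorMap_tmul, map_smul, hf,
    LinearMap.id_apply]

theorem rightUnitorMap_map {M : YDData H p} {M' : YDData H p'} {f : M.carrier →ₗ[k] M'.carrier}
    (hf : ∀ m, f (M.μ m) = M'.μ (f m)) :
    (rightUnitorMap M').toLinearMap ∘ₗ map f LinearMap.id =
      f ∘ₗ (rightUnitorMap M).toLinearMap := by
  refine TensorProduct.ext' fun x m => ?_
  simp only [LinearMap.comp_apply, map_tmul, LinearEquiv.coe_coe, rightUnitorMap_tmul, map_smul, hf,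
    LinearMap.id_apply]

theorem pentagon {a b c : G} (M : YDData H p) (N : YDData H q) (L : YDData H r) (K : YDData H s)
    (h₁ : p * q = a) (h₂ : q * r = b) (h₃ : r * s = c) :
    (map LinearMap.id (assocMap N L K).toLinearMap ∘ₗ
        (assocMap M (N.tensor L h₂) K).toLinearMap) ∘ₗ
        map (assocMap M N L).toLinearMap LinearMap.id =
      (assocMap M N (L.tensor K h₃)).toLinearMap ∘ₗ
        (assocMap (M.tensor N h₁) L K).toLinearMap :=
  TensorProduct.ext_fourfold fun _ _ _ _ => rfl

theorem triangle (M : YDData H p) (N : YDData H q) :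
    map LinearMap.id (leftUnitorMap N).toLinearMap ∘ₗ
        (assocMap M (YDData.unit H) N).toLinearMap =
      map (rightUnitorMap M).toLinearMap LinearMap.id := by
  refine TensorProduct.ext_threefold fun m x n => ?_
  refine (congrArg (map LinearMap.id (leftUnitorMap N).toLinearMap)
    (assocMap_tmul M (YDData.unit H) N m x n)).trans ?_
  simp only [map_tmul, LinearEquiv.coe_coe, leftUnitorMap_tmul, rightUnitorMap_tmul,
    LinearMap.id_apply, LinearEquiv.apply_symm_apply, tmul_smul, smul_tmul']

end YDData

namespace YD

/-! ### The monoidal category of Yetter-Drinfeld modules -/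

/-- The coherence laws are checked on underlying linear maps. -/
noncomputable instance : MonoidalCategory (YD H) := .ofTensorHom
  (id_tensorHom_id := fun X Y => hom_ext <|
    (lin_tensorHom_eq (lin_id X) (lin_id Y)).trans TensorProduct.map_id)
  (id_tensorHom := fun _ _ _ _ => rfl)
  (tensorHom_id := fun _ _ => rfl)
  (tensorHom_comp_tensorHom := fun f₁ f₂ g₁ g₂ => hom_ext <|
    ((lin_comp_eq (lin_tensorHom_eq rfl rfl) (lin_tensorHom_eq rfl rfl)).trans
      (TensorProduct.map_comp _ _ _ _).symm).trans
      (lin_tensorHom_eq (lin_comp f₁ g₁) (lin_comp f₂ g₂)).symm)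
  (associator_naturality := fun f₁ f₂ f₃ => hom_ext <|
    ((lin_comp_eq (lin_tensorHom_eq (lin_tensorHom_eq rfl rfl) rfl)
      (lin_associator_hom _ _ _)).trans
      (YDData.assocMap_map (lin f₂) (lin_μ f₁) (lin_μ f₃))).trans
      (lin_comp_eq (lin_associator_hom _ _ _)
        (lin_tensorHom_eq rfl (lin_tensorHom_eq rfl rfl))).symm)
  (leftUnitor_naturality := fun f => hom_ext <|
    ((lin_comp_eq (lin_tensorHom_eq (lin_id _) rfl) (lin_leftUnitor_hom _)).trans
      (YDData.leftUnitorMap_map (lin_μ f))).trans (lin_comp_eq (lin_leftUnitor_hom _) rfl).symm)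
  (rightUnitor_naturality := fun f => hom_ext <|
    ((lin_comp_eq (lin_tensorHom_eq rfl (lin_id _)) (lin_rightUnitor_hom _)).trans
      (YDData.rightUnitorMap_map (lin_μ f))).trans (lin_comp_eq (lin_rightUnitor_hom _) rfl).symm)
  (pentagon := fun W X Y Z => hom_ext <|
    ((lin_comp_eq (lin_whiskerRight_eq (lin_associator_hom W X Y) Z)
      (lin_comp_eq (lin_associator_hom W (X ⊗ Y) Z)
        (lin_whiskerLeft_eq W (lin_associator_hom X Y Z)))).trans
      (YDData.pentagon W.2.data X.2.data Y.2.data Z.2.data rfl rfl rfl)).trans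
      (lin_comp_eq (lin_associator_hom (W ⊗ X) Y Z) (lin_associator_hom W X (Y ⊗ Z))).symm)
  (triangle := fun X Y => hom_ext <|
    ((lin_comp_eq (lin_associator_hom X (𝟙_ _) Y)
      (lin_whiskerLeft_eq X (lin_leftUnitor_hom Y))).trans
      (YDData.triangle X.2.data Y.2.data)).trans
      (lin_whiskerRight_eq (lin_rightUnitor_hom X) Y).symm)

end YD

end YDBraided

section YDBraidedT

open TensorProduct CategoryTheory MonoidalCategory

variable {k : Type u} [Field k] {G : Type v} [Group G] {H : HomHopfTCoalgebra.{u, v, w} k G}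

namespace YD

variable {X X' Y Y' Z : YD H}

/-! ### Equalities between objects and the conjugation functors -/

/-- Composing with a morphism given by an equality of objects does not change the underlying map.
The hypothesis `h` holds by `HEq.rfl` when the underlying spaces of `X` and `X'` agree
definitionally. -/
theorem lin_eqToHom_comp (e : X = X') {f : X' ⟶ Y}
    {φ : X'.2.data.carrier →ₗ[k] Y.2.data.carrier} {ψ : X.2.data.carrier →ₗ[k] Y.2.data.carrier}
    (hf : lin f = φ) (h : HEq φ ψ) : lin (eqToHom e ≫ f) = ψ := by
  subst e
  rw [eqToHom_refl, Category.id_comp, hf, eq_of_heq h]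

theorem lin_comp_eqToHom (e : Y = Y') {f : X ⟶ Y}
    {φ : X.2.data.carrier →ₗ[k] Y.2.data.carrier} {ψ : X.2.data.carrier →ₗ[k] Y'.2.data.carrier}
    (hf : lin f = φ) (h : HEq φ ψ) : lin (f ≫ eqToHom e) = ψ := by
  subst e
  rw [eqToHom_refl, Category.comp_id, hf, eq_of_heq h]

/-- Writing the degree `g p g⁻¹` of a conjugate differently does not change the object. -/
theorem conjObj_eq {p s : G} (g : G) (M : YDMod H p) (h : g * p * g⁻¹ = s) :
    ((struct H).conj g).obj ⟨p, M⟩ = ⟨s, conjMod (ydWellDefined H) g M h⟩ := by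
  subst h
  rfl

theorem conjObj_one (X : YD H) : ((struct H).conj 1).obj X = X :=
  have h : 1 * X.1 * 1⁻¹ = X.1 := by group
  (conjObj_eq 1 X.2 h).trans (mk_data_congr (X.2.data.conj_one h))

theorem conjObj_mul (g g' : G) (X : YD H) :
    ((struct H).conj (g * g')).obj X = ((struct H).conj g).obj (((struct H).conj g').obj X) :=
  have h : g * g' * X.1 * (g * g')⁻¹ = g * (g' * X.1 * g'⁻¹) * g⁻¹ := by group
  (conjObj_eq (g * g') X.2 h).trans
    (mk_data_congr (N := conjMod (ydWellDefined H) g (conjMod (ydWellDefined H) g' X.2 rfl) rfl)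
      (X.2.data.conj_conj g g' rfl rfl h))

theorem conjObj_tensor (g : G) (X Y : YD H) :
    ((struct H).conj g).obj (X ⊗ Y) = ((struct H).conj g).obj X ⊗ ((struct H).conj g).obj Y :=
  (mk_data_congr (M := conjMod (ydWellDefined H) g (tensorMod (ydWellDefined H) X.2 Y.2 rfl) rfl)
      (N := tensorMod (ydWellDefined H) (conjMod (ydWellDefined H) g X.2 rfl)
        (conjMod (ydWellDefined H) g Y.2 rfl) conj_mul)
      (X.2.data.conj_tensor g Y.2.data rfl rfl rfl rfl _)).trans
    (tensorObj_eq (ydWellDefined H) _ _ _)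

theorem conjObj_unit (g : G) : ((struct H).conj g).obj (𝟙_ (YD H)) = 𝟙_ (YD H) :=
  have h : g * 1 * g⁻¹ = 1 := by group
  (conjObj_eq g (unitMod (ydWellDefined H)) h).trans
    (mk_data_congr (N := unitMod (ydWellDefined H)) (YDData.conj_unit g h))

theorem conj_one : (struct H).conj 1 = 𝟭 (YD H) :=
  CategoryTheory.Functor.ext conjObj_one fun X Y f => hom_ext <|
    (lin_conj_map 1 f).trans
      (lin_eqToHom_comp (conjObj_one X)
        (lin_comp_eqToHom (conjObj_one Y).symm (f := (𝟭 (YD H)).map f)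
          (ψ := lin (X := X) (Y := Y) f) rfl HEq.rfl)
        HEq.rfl).symm

theorem conj_mul (g g' : G) :
    (struct H).conj (g * g') = (struct H).conj g' ⋙ (struct H).conj g :=
  CategoryTheory.Functor.ext (conjObj_mul g g') fun X Y f => hom_ext <|
    (lin_conj_map (g * g') f).trans
      (lin_eqToHom_comp (conjObj_mul g g' X)
        (lin_comp_eqToHom (conjObj_mul g g' Y).symm
          (f := ((struct H).conj g' ⋙ (struct H).conj g).map f) (ψ := lin (X := X) (Y := Y) f)
          ((lin_conj_map g _).trans (lin_conj_map g' f)) HEq.rfl) HEq.rfl).symm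

-- In the next lemmas the equalities of objects are variables, so that they apply with whichever
-- proofs of these equalities occur in `BraidedTCategory`.

theorem conj_associator (g : G) (X Y Z : YD H)
    (e : ((struct H).conj g).obj ((X ⊗ Y) ⊗ Z) =
      (((struct H).conj g).obj X ⊗ ((struct H).conj g).obj Y) ⊗ ((struct H).conj g).obj Z)
    (e' : ((struct H).conj g).obj X ⊗ (((struct H).conj g).obj Y ⊗ ((struct H).conj g).obj Z) =
      ((struct H).conj g).obj (X ⊗ (Y ⊗ Z))) :
    ((struct H).conj g).map (α_ X Y Z).hom =
      eqToHom e ≫ (α_ (((struct H).conj g).obj X) (((struct H).conj g).obj Y)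
        (((struct H).conj g).obj Z)).hom ≫ eqToHom e' :=
  have h : lin ((α_ (((struct H).conj g).obj X) (((struct H).conj g).obj Y)
      (((struct H).conj g).obj Z)).hom ≫ eqToHom e') =
      (YDData.assocMap X.2.data Y.2.data Z.2.data).toLinearMap :=
    lin_comp_eqToHom e' (lin_associator_hom _ _ _) HEq.rfl
  hom_ext <| ((lin_conj_map g _).trans (lin_associator_hom X Y Z)).trans
    (lin_eqToHom_comp e h HEq.rfl).symm

theorem conj_leftUnitor (g : G) (X : YD H)
    (e : ((struct H).conj g).obj (𝟙_ (YD H) ⊗ X) = 𝟙_ (YD H) ⊗ ((struct H).conj g).obj X) :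
    ((struct H).conj g).map (λ_ X).hom = eqToHom e ≫ (λ_ (((struct H).conj g).obj X)).hom :=
  have h : lin (eqToHom e ≫ (λ_ (((struct H).conj g).obj X)).hom) =
      (YDData.leftUnitorMap X.2.data).toLinearMap :=
    lin_eqToHom_comp e (lin_leftUnitor_hom (((struct H).conj g).obj X)) HEq.rfl
  hom_ext <| ((lin_conj_map g _).trans (lin_leftUnitor_hom X)).trans h.symm

theorem conj_rightUnitor (g : G) (X : YD H)
    (e : ((struct H).conj g).obj (X ⊗ 𝟙_ (YD H)) = ((struct H).conj g).obj X ⊗ 𝟙_ (YD H)) :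
    ((struct H).conj g).map (ρ_ X).hom = eqToHom e ≫ (ρ_ (((struct H).conj g).obj X)).hom :=
  have h : lin (eqToHom e ≫ (ρ_ (((struct H).conj g).obj X)).hom) =
      (YDData.rightUnitorMap X.2.data).toLinearMap :=
    lin_eqToHom_comp e (lin_rightUnitor_hom (((struct H).conj g).obj X)) HEq.rfl
  hom_ext <| ((lin_conj_map g _).trans (lin_rightUnitor_hom X)).trans h.symm

/-! ### The braided T-category of Yetter-Drinfeld modules -/

theorem isIso_braid (X Y : YD H) : IsIso ((struct H).braid X Y) :=
  isIso_of_bijective _ <| by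
    rw [lin_braid]
    exact (YDData.braidEquiv X.2.isYD Y.2.isYD).symm.bijective

theorem braid_naturality (f : X ⟶ X') (f' : Y ⟶ Y')
    (e : ((struct H).conj X'.1).obj Y' ⊗ X' = ((struct H).conj X.1).obj Y' ⊗ X') :
    (struct H).braid X Y ≫ (((struct H).conj X.1).map f' ⊗ₘ f) =
      (f ⊗ₘ f') ≫ (struct H).braid X' Y' ≫ eqToHom e := by
  refine hom_ext ((lin_comp_eq (lin_braid X Y)
    (lin_tensorHom_eq (lin_conj_map X.1 f') rfl)).trans
    (Eq.trans ?_ (lin_comp_eq (lin_tensorHom_eq rfl rfl)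
      (lin_comp_eqToHom e (lin_braid X' Y')
        (ψ := YDData.braidMap X'.2.data Y'.2.data) HEq.rfl)).symm))
  obtain ⟨f⟩ := f
  obtain ⟨f'⟩ := f'
  exact LinearMap.ext (YDData.braidMap_map f.isHom f'.isHom)

theorem hexagon_left (X Y Z : YD H) :
    ((struct H).braid X Y ▷ Z) ≫ (α_ (((struct H).conj X.1).obj Y) X Z).hom ≫
        (((struct H).conj X.1).obj Y ◁ (struct H).braid X Z) =
      (α_ X Y Z).hom ≫ (struct H).braid X (Y ⊗ Z) ≫
        eqToHom (congrArg (· ⊗ X) (conjObj_tensor X.1 Y Z)) ≫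
        (α_ (((struct H).conj X.1).obj Y) (((struct H).conj X.1).obj Z) X).hom := by
  refine hom_ext ((lin_comp_eq (lin_whiskerRight_eq (lin_braid X Y) Z)
    (lin_comp_eq (lin_associator_hom (((struct H).conj X.1).obj Y) X Z)
      (lin_whiskerLeft_eq (((struct H).conj X.1).obj Y) (lin_braid X Z)))).trans
    (Eq.trans ?_ (lin_comp_eq (lin_associator_hom X Y Z)
      (lin_comp_eq (lin_braid X (Y ⊗ Z)) (lin_eqToHom_comp _
        (lin_associator_hom (((struct H).conj X.1).obj Y) (((struct H).conj X.1).obj Z) X)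
        (ψ := (YDData.assocMap (((struct H).conj X.1).obj Y).2.data
          (((struct H).conj X.1).obj Z).2.data X.2.data).toLinearMap) HEq.rfl))).symm))
  exact LinearMap.ext fun x => YDData.hexagon_left rfl X.2.isYD Y.2.isYD Z.2.isYD x

theorem hexagon_right (X Y Z : YD H) :
    (α_ X Y Z).inv ≫ (struct H).braid (X ⊗ Y) Z ≫
        (α_ (((struct H).conj (X.1 * Y.1)).obj Z) X Y).inv ≫
        eqToHom (congrArg (fun A => (A ⊗ X) ⊗ Y) (conjObj_mul X.1 Y.1 Z)) =
      (X ◁ (struct H).braid Y Z) ≫ (α_ X (((struct H).conj Y.1).obj Z) Y).inv ≫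
        ((struct H).braid X (((struct H).conj Y.1).obj Z) ▷ Y) := by
  refine hom_ext ((lin_comp_eq (lin_associator_inv X Y Z)
    (lin_comp_eq (lin_braid (X ⊗ Y) Z) (lin_comp_eqToHom _
      (lin_associator_inv (((struct H).conj (X.1 * Y.1)).obj Z) X Y)
      (ψ := (YDData.assocMap (((struct H).conj (X.1 * Y.1)).obj Z).2.data
        X.2.data Y.2.data).symm.toLinearMap) HEq.rfl))).trans
    (Eq.trans ?_ (lin_comp_eq (lin_whiskerLeft_eq X (lin_braid Y Z))
      (lin_comp_eq (lin_associator_inv X (((struct H).conj Y.1).obj Z) Y)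
        (lin_whiskerRight_eq (lin_braid X (((struct H).conj Y.1).obj Z)) Y))).symm))
  exact LinearMap.ext fun x => YDData.hexagon_right rfl rfl X.2.isYD Y.2.isYD Z.2.isYD x

theorem conj_braid (g : G) (X Y : YD H)
    (e : ((struct H).conj (g * X.1 * g⁻¹)).obj (((struct H).conj g).obj Y) ⊗
        ((struct H).conj g).obj X = ((struct H).conj g).obj (((struct H).conj X.1).obj Y ⊗ X)) :
    ((struct H).conj g).map ((struct H).braid X Y) =
      eqToHom (conjObj_tensor g X Y) ≫
        (struct H).braid (((struct H).conj g).obj X) (((struct H).conj g).obj Y) ≫ eqToHom e := by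
  refine hom_ext (((lin_conj_map g _).trans (lin_braid X Y)).trans
    (Eq.trans ?_ (lin_eqToHom_comp (conjObj_tensor g X Y)
      (lin_comp_eqToHom e (lin_braid (((struct H).conj g).obj X) (((struct H).conj g).obj Y))
        (ψ := YDData.braidMap (((struct H).conj g).obj X).2.data (((struct H).conj g).obj Y).2.data)
        HEq.rfl)
      (ψ := YDData.braidMap (X.2.data.conj g rfl) (Y.2.data.conj g rfl)) HEq.rfl).symm))
  exact LinearMap.ext (YDData.braidMap_conj g rfl rfl X.2.isYD Y.2.isYD)

/-- The category of Yetter-Drinfeld modules is a braided `T`-category. -/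
noncomputable def braidedTCategory (H : HomHopfTCoalgebra.{u, v, w} k G) :
    BraidedTCategory G (YD H) :=
  { struct H, (inferInstance : MonoidalCategory (YD H)) with
    deg_eq_of_hom := fun ⟨_⟩ => rfl
    deg_unit := rfl
    deg_tensor := fun _ _ => rfl
    conj_one := conj_one
    conj_mul := conj_mul
    deg_conj := fun _ _ => rfl
    conj_tensor := conjObj_tensor
    conj_unit := conjObj_unit
    conj_tensorHom := fun g {X X' Y Y'} f f' => hom_ext <|
      ((lin_conj_map g _).trans (lin_tensorHom_eq rfl rfl)).trans
      (lin_eqToHom_comp (conjObj_tensor g X Y)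
        (lin_comp_eqToHom (conjObj_tensor g X' Y').symm
          (ψ := TensorProduct.map (lin f) (lin f'))
          (lin_tensorHom_eq (lin_conj_map g f) (lin_conj_map g f')) HEq.rfl) HEq.rfl).symm
    conj_associator := fun g X Y Z => conj_associator g X Y Z _ _
    conj_leftUnitor := fun g X => conj_leftUnitor g X _
    conj_rightUnitor := fun g X => conj_rightUnitor g X _
    braid_isIso := isIso_braid
    braid_naturality := fun f f' => braid_naturality f f' _
    hexagon_left := hexagon_left
    hexagon_right := hexagon_right
    conj_braid := fun g X Y => conj_braid g X Y _ }

end YD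

end YDBraidedT

theorem theorem4p5 {k : Type u} [Field k] {G : Type v} [Group G]
    (H : HomHopfTCoalgebra.{u, v, w} k G) (hS : H.BijectiveAntipode) :
    ∃ (W : YDWellDefined H) (T : BraidedTCategory G (YD H)),
      T.toTCategoryStruct = YD.tCategoryStruct W :=
  ⟨ydWellDefined H, YD.braidedTCategory H, rfl⟩
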